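/- Let $k\ge 1$, let $a,e\in\mathbb R$ be such that $P(x,y)=xy^2+ay-e$ is irreducible (i.e. $e\neq 0$), and let $C=\{(x,y)\in\mathbb R^2: P(x,y)=0\}$. Let $I\subseteq\mathbb R[x,y]$ be the ideal of polynomials vanishing on $C$, $\mathbb R[C]=\mathbb R[x,y]/I$, $I_{\le m}=I\cap\mathbb R[x,y]_{\le m}$, where $\mathbb R[x,y]_{\le m}$ denotes the polynomials of total degree at most $m$, and let $\mathbb R[C]_{\le m}$ be the image of $\mathbb R[x,y]_{\le m}$ in $\mathbb R[C]$. In $\mathbb R[C]$ put $$\mathcal B_k=\{x^k,\,x^{k-1},x^{k-1}y,\ldots,x,xy,\,1,y,\ldots,y^k\},\qquad \widetilde{\mathcal B}_k=(\mathcal B_k\setminus\{x^k\})\cup\{x^ky\},$$ $$V^{(k)}=\operatorname{Lin}\widetilde{\mathcal B}_k,\quad U=\operatorname{Lin}(\mathcal B_k\setminus\{x^k\}),\quad W=\operatorname{Lin}(\mathcal B_k\setminus\{y^k\}),\quad Z=\operatorname{Lin}(\widetilde{\mathcal B}_k\setminus\{y^k\}).$$ Let $L:\mathbb R[x,y]_{\le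 2k}\to\mathbb R$ be a linear functional that vanishes on $I_{\le 2k}$, let $L_C:\mathbb R[C]_{\le 2k}\to\mathbb R$, $L_C(f+I)=L(f)$, be the induced functional, and consider the bilinear forms $$\overline L(f,g)=L(fg)\ \text{ on }\mathbb R[x,y]_{\le k},\qquad \overline L_C(f,g)=L_C(fg)\ \text{ on }\mathbb R[C]_{\le k},\qquad \overline L_{C,V^{(k)},1}(g,h)=L_C(gh)\ \text{ on }V^{(k)}$$ (products of elements of $V^{(k)}$ lie in $\mathbb R[C]_{\le 2k}$). Assume that $L$ is $C$-singular, i.e. that $\ker\overline L\neq I_{\le k}$ or $\ker\overline L_{C,V^{(k)},1}\neq\{0\}$. Then the following are equivalent: 1. $L$ is a $C$-moment functional: there is a positive Borel measure $\mu$ on $\mathbb R^2$ supported on $C$ such that $L(f)=\int_C f\,d\mu$ for every $f\in\mathbb R[x,y]_{\le 2k}$ (all these integrals being finite). 2. $L_C(g^2)\ge 0$ for every $0\ne g\in\mathbb R[C]_{\le k}$ (square positivity), $L_C(g^2)\ge 0$ for every $0\ne g\in V^{(k)}$ ($(V^{(k)},1)$-local square positivity), $$\operatorname{rank}\overline L_C=\operatorname{rank}\big(\overline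 L_C|_U\big),$$ and at least one of the following holds: (a) $\operatorname{rank}\overline L_C=\operatorname{rank}\big(\overline L_C|_W\big)$; (b) $\operatorname{rank}\overline L_{C,V^{(k)},1}=\operatorname{rank}\big(\overline L_{C,V^{(k)},1}|_Z\big)$. -/

import Mathlib

namespace CubicTMP

open MvPolynomial

noncomputable section

/-- Real polynomials in two variables; `X 0` is `x` and `X 1` is `y`. -/
abbrev Poly : Type := MvPolynomial (Fin 2) ℝ

/-- `ℝ[x,y]_{≤ m}`: polynomials of total degree at most `m`. -/
abbrev PolyLE (m : ℕ) : Submodule ℝ Poly := restrictTotalDegree (Fin 2) ℝ m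

/-- The real zero set `𝒵(P)` of a polynomial in the plane. -/
def zeroSet (P : Poly) : Set (Fin 2 → ℝ) := {z | eval z P = 0}

/-- The coordinate ring `ℝ[C] = ℝ[x,y] / I`, with `I` the ideal of all polynomials vanishing
on `C`. -/
def CoordRing (C : Set (Fin 2 → ℝ)) : Type := Poly ⧸ vanishingIdeal ℝ C

instance (C : Set (Fin 2 → ℝ)) : CommRing (CoordRing C) :=
  inferInstanceAs (CommRing (Poly ⧸ vanishingIdeal ℝ C))

instance (C : Set (Fin 2 → ℝ)) : Algebra ℝ (CoordRing C) :=
  inferInstanceAs (Algebra ℝ (Poly ⧸ vanishingIdeal ℝ C))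

/-- The restriction map `ℝ[x,y] → ℝ[C]`. -/
def toCoord (C : Set (Fin 2 → ℝ)) : Poly →ₐ[ℝ] CoordRing C :=
  Ideal.Quotient.mkₐ ℝ (vanishingIdeal ℝ C)

theorem toCoord_eq_zero_iff {C : Set (Fin 2 → ℝ)} {p : Poly} :
    toCoord C p = 0 ↔ p ∈ vanishingIdeal ℝ C :=
  Ideal.Quotient.eq_zero_iff_mem

/-- `ℝ[C]_{≤ m}`: the image of `ℝ[x,y]_{≤ m}` in `ℝ[C]`. -/
def CoordLE (C : Set (Fin 2 → ℝ)) (m : ℕ) : Submodule ℝ (CoordRing C) :=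
  (PolyLE m).map (toCoord C).toLinearMap

/-- `I_{≤ m} = I ∩ ℝ[x,y]_{≤ m}`, as a subspace of `ℝ[x,y]_{≤ m}`. -/
def idealLE (C : Set (Fin 2 → ℝ)) (m : ℕ) : Submodule ℝ (PolyLE m) :=
  ((vanishingIdeal ℝ C).restrictScalars ℝ).submoduleOf (PolyLE m)

/-- The restriction map `ℝ[x,y]_{≤ m} → ℝ[C]_{≤ m}`. -/
def toCoordLE (C : Set (Fin 2 → ℝ)) (m : ℕ) : PolyLE m →ₗ[ℝ] CoordLE C m :=
  (toCoord C).toLinearMap.submoduleMap (PolyLE m)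

theorem toCoordLE_surjective (C : Set (Fin 2 → ℝ)) (m : ℕ) :
    Function.Surjective (toCoordLE C m) :=
  LinearMap.submoduleMap_surjective _ _

theorem ker_toCoordLE (C : Set (Fin 2 → ℝ)) (m : ℕ) :
    LinearMap.ker (toCoordLE C m) = idealLE C m := by
  ext p
  rw [LinearMap.mem_ker, ← Subtype.coe_inj]
  exact toCoord_eq_zero_iff

/-- `L` vanishes on `I_{≤ m}`, i.e. the induced functional `L_C` is well defined. -/
def Descends (C : Set (Fin 2 → ℝ)) {m : ℕ} (L : PolyLE m →ₗ[ℝ] ℝ) : Prop :=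
  ∀ p ∈ idealLE C m, L p = 0

/-- The functional `L_C : ℝ[C]_{≤ m} → ℝ`, `L_C (p + I) = L p`. -/
def inducedFunctional (C : Set (Fin 2 → ℝ)) {m : ℕ} (L : PolyLE m →ₗ[ℝ] ℝ)
    (hL : Descends C L) : CoordLE C m →ₗ[ℝ] ℝ :=
  ((LinearMap.ker (toCoordLE C m)).liftQ L
      (fun p hp => hL p (by rwa [ker_toCoordLE] at hp))).comp
    ((toCoordLE C m).quotKerEquivOfSurjective (toCoordLE_surjective C m)).symm.toLinearMap

theorem inducedFunctional_apply (C : Set (Fin 2 → ℝ)) {m : ℕ} (L : PolyLE m →ₗ[ℝ] ℝ)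
    (hL : Descends C L) (p : PolyLE m) :
    inducedFunctional C L hL (toCoordLE C m p) = L p := by
  have h : ((toCoordLE C m).quotKerEquivOfSurjective (toCoordLE_surjective C m)).symm
      (toCoordLE C m p) = Submodule.Quotient.mk p := by
    rw [LinearEquiv.symm_apply_eq]
    rfl
  rw [inducedFunctional, LinearMap.comp_apply, LinearEquiv.coe_coe, h]
  exact Submodule.liftQ_apply _ _ _

theorem mul_mem_polyLE {k : ℕ} {p q : Poly} (hp : p ∈ PolyLE k) (hq : q ∈ PolyLE k) :
    p * q ∈ PolyLE (2 * k) := by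
  rw [mem_restrictTotalDegree] at *
  exact (totalDegree_mul p q).trans (by omega)

theorem mul_mem_coordLE {C : Set (Fin 2 → ℝ)} {k : ℕ} {g h : CoordRing C}
    (hg : g ∈ CoordLE C k) (hh : h ∈ CoordLE C k) : g * h ∈ CoordLE C (2 * k) := by
  obtain ⟨p, hp, rfl⟩ := hg
  obtain ⟨q, hq, rfl⟩ := hh
  exact ⟨p * q, mul_mem_polyLE hp hq, map_mul (toCoord C) p q⟩

/-- The bilinear form `L̄ (p, q) = L (p q)` on `ℝ[x,y]_{≤ k}`. -/
def polyForm {k : ℕ} (L : PolyLE (2 * k) →ₗ[ℝ] ℝ) : LinearMap.BilinForm ℝ (PolyLE k) :=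
  LinearMap.mk₂ ℝ (fun p q => L ⟨p.1 * q.1, mul_mem_polyLE p.2 q.2⟩)
    (fun p p' q => by rw [← map_add]; congr 1; ext1; simp [add_mul])
    (fun c p q => by rw [← map_smul]; congr 1; ext1; simp)
    (fun p q q' => by rw [← map_add]; congr 1; ext1; simp [mul_add])
    (fun c p q => by rw [← map_smul]; congr 1; ext1; simp)

/-- The localized bilinear form `(g, h) ↦ ℓ (f g h)` on a subspace `V` of `ℝ[C]` such that
`f g h ∈ ℝ[C]_{≤ m}` for all `g, h ∈ V`. -/
def localForm {C : Set (Fin 2 → ℝ)} {m : ℕ} (ℓ : CoordLE C m →ₗ[ℝ] ℝ)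
    (V : Submodule ℝ (CoordRing C)) (f : CoordRing C)
    (hV : ∀ g ∈ V, ∀ h ∈ V, f * (g * h) ∈ CoordLE C m) : LinearMap.BilinForm ℝ V :=
  LinearMap.mk₂ ℝ (fun g h => ℓ ⟨f * (g.1 * h.1), hV g.1 g.2 h.1 h.2⟩)
    (fun p p' q => by rw [← map_add]; congr 1; ext1; simp [add_mul, mul_add])
    (fun c p q => by rw [← map_smul]; congr 1; ext1; simp)
    (fun p q q' => by rw [← map_add]; congr 1; ext1; simp [mul_add])
    (fun c p q => by rw [← map_smul]; congr 1; ext1; simp)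

/-- The bilinear form `(g, h) ↦ ℓ (g h)` on `ℝ[C]_{≤ k}`. -/
def coordForm {C : Set (Fin 2 → ℝ)} {k : ℕ} (ℓ : CoordLE C (2 * k) →ₗ[ℝ] ℝ) :
    LinearMap.BilinForm ℝ (CoordLE C k) :=
  LinearMap.mk₂ ℝ (fun g h => ℓ ⟨g.1 * h.1, mul_mem_coordLE g.2 h.2⟩)
    (fun p p' q => by rw [← map_add]; congr 1; ext1; simp [add_mul])
    (fun c p q => by rw [← map_smul]; congr 1; ext1; simp)
    (fun p q q' => by rw [← map_add]; congr 1; ext1; simp [mul_add])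
    (fun c p q => by rw [← map_smul]; congr 1; ext1; simp)

/-- `ker B = {v | B (u, v) = 0 for every u}`. -/
def formKer {V : Type} [AddCommGroup V] [Module ℝ V] (B : LinearMap.BilinForm ℝ V) :
    Submodule ℝ V :=
  LinearMap.ker (LinearMap.flip B)

/-- The rank of a bilinear form (the rank of its matrix in any basis), as the rank of the linear
map `V → V*`, `u ↦ B (u, ·)`. -/
def formRank {V : Type} [AddCommMonoid V] [Module ℝ V] (B : LinearMap.BilinForm ℝ V) : Cardinal :=
  LinearMap.rank B

/-- The restriction of a bilinear form on a subspace `V` to a subspace `U ⊆ V`. -/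
def restrictForm {M : Type} [AddCommGroup M] [Module ℝ M] {V : Submodule ℝ M}
    (B : LinearMap.BilinForm ℝ V) (U : Submodule ℝ M) :
    LinearMap.BilinForm ℝ (U.submoduleOf V) :=
  LinearMap.BilinForm.restrict B (U.submoduleOf V)

/-- A bilinear form is nonnegative on the diagonal: `B (g, g) ≥ 0` for all `g ≠ 0`. Applied to
`coordForm` this is square positivity, applied to `localForm` local square positivity. -/
def SquarePositive {V : Type} [AddCommGroup V] [Module ℝ V] (B : LinearMap.BilinForm ℝ V) : Prop :=
  ∀ g : V, g ≠ 0 → 0 ≤ B g g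

/-- `L` is a `C`-moment functional: it is integration against a (positive) Borel measure on the
plane that is supported on `C`. -/
def IsMomentFunctional (C : Set (Fin 2 → ℝ)) {m : ℕ} (L : PolyLE m →ₗ[ℝ] ℝ) : Prop :=
  ∃ μ : MeasureTheory.Measure (Fin 2 → ℝ), μ Cᶜ = 0 ∧
    ∀ p : PolyLE m, MeasureTheory.IntegrableOn (fun z => eval z p.1) C μ ∧
      L p = ∫ z in C, eval z p.1 ∂μ

/-- The cubic `x y² + a y - d x - e`. -/
def P6 (a d e : ℝ) : Poly := X 0 * X 1 ^ 2 + C a * X 1 - C d * X 0 - C e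

section Curve

variable (a d e : ℝ)

/-- The real curve `x y² + a y - d x - e = 0`. -/
def curve6 : Set (Fin 2 → ℝ) := zeroSet (P6 a d e)

/-- The coordinate function `x` in `ℝ[C]`. -/
def xC : CoordRing (curve6 a d e) := toCoord (curve6 a d e) (X 0)

/-- The coordinate function `y` in `ℝ[C]`. -/
def yC : CoordRing (curve6 a d e) := toCoord (curve6 a d e) (X 1)

/-- `𝓑_k = {x^k, x^(k-1), x^(k-1) y, …, x, x y, 1, y, …, y^k}`. -/
def basisB (k : ℕ) : Set (CoordRing (curve6 a d e)) :=
  {g | g = xC a d e ^ k ∨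
    (∃ i : ℕ, 1 ≤ i ∧ i < k ∧ (g = xC a d e ^ i ∨ g = xC a d e ^ i * yC a d e)) ∨
    ∃ j : ℕ, j ≤ k ∧ g = yC a d e ^ j}

/-- `𝓑̃_k = (𝓑_k ∖ {x^k}) ∪ {x^k y}`. -/
def basisBtilde (k : ℕ) : Set (CoordRing (curve6 a d e)) :=
  (basisB a d e k \ {xC a d e ^ k}) ∪ {xC a d e ^ k * yC a d e}

/-- `V^(k) = span 𝓑̃_k`. -/
def spaceV (k : ℕ) : Submodule ℝ (CoordRing (curve6 a d e)) :=
  Submodule.span ℝ (basisBtilde a d e k)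

/-- `U = span (𝓑_k ∖ {x^k})`. -/
def spaceU (k : ℕ) : Submodule ℝ (CoordRing (curve6 a d e)) :=
  Submodule.span ℝ (basisB a d e k \ {xC a d e ^ k})

/-- `W = span (𝓑_k ∖ {y^k})`. -/
def spaceW (k : ℕ) : Submodule ℝ (CoordRing (curve6 a d e)) :=
  Submodule.span ℝ (basisB a d e k \ {yC a d e ^ k})

/-- `Z = span (𝓑̃_k ∖ {y^k})`. -/
def spaceZ (k : ℕ) : Submodule ℝ (CoordRing (curve6 a d e)) :=
  Submodule.span ℝ (basisBtilde a d e k \ {yC a d e ^ k})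

theorem monomial_mem_coordLE {i j m : ℕ} (h : i + j ≤ m) :
    xC a d e ^ i * yC a d e ^ j ∈ CoordLE (curve6 a d e) m := by
  refine ⟨X 0 ^ i * X 1 ^ j, ?_, ?_⟩
  · refine (mem_restrictTotalDegree _ _ _).2 ((totalDegree_mul _ _).trans ?_)
    rw [totalDegree_X_pow, totalDegree_X_pow]
    exact h
  · exact (map_mul (toCoord (curve6 a d e)) _ _).trans (by rw [map_pow, map_pow]; rfl)

theorem curve6_relation :
    xC a d e * yC a d e ^ 2 = d • xC a d e + e • 1 - a • yC a d e := by
  have h : toCoord (curve6 a d e) (P6 a d e) = 0 := by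
    refine toCoord_eq_zero_iff.2 ?_
    intro z hz
    exact hz
  have h2 : toCoord (curve6 a d e) (P6 a d e) =
      xC a d e * yC a d e ^ 2 + a • yC a d e - d • xC a d e - e • 1 := by
    simp only [P6, map_sub, map_add, map_mul, map_pow, ← algebraMap_eq, AlgHom.commutes,
      Algebra.smul_def, mul_one]
    rfl
  rw [h] at h2
  rw [eq_comm, ← sub_eq_zero] at h2
  rw [← sub_eq_zero, ← h2]
  abel

theorem basisB_subset (k : ℕ) :
    basisB a d e k ⊆ CoordLE (curve6 a d e) k := by
  rintro g (rfl | ⟨i, hi, hik, rfl | rfl⟩ | ⟨j, hj, rfl⟩)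
  · simpa using monomial_mem_coordLE a d e (i := k) (j := 0) le_rfl
  · simpa using monomial_mem_coordLE a d e (i := i) (j := 0) hik.le
  · simpa using monomial_mem_coordLE a d e (i := i) (j := 1) (by omega)
  · simpa using monomial_mem_coordLE a d e (i := 0) (j := j) (by omega)

theorem spaceU_le (k : ℕ) : spaceU a d e k ≤ CoordLE (curve6 a d e) k :=
  Submodule.span_le.2 (Set.diff_subset.trans (basisB_subset a d e k))

theorem spaceW_le (k : ℕ) : spaceW a d e k ≤ CoordLE (curve6 a d e) k :=
  Submodule.span_le.2 (Set.diff_subset.trans (basisB_subset a d e k))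

theorem spaceZ_le (k : ℕ) : spaceZ a d e k ≤ spaceV a d e k :=
  Submodule.span_mono Set.diff_subset

/-- All products of two elements of `V^(k)` lie in `ℝ[C]_{≤ 2k}`. -/
theorem spaceV_mul_mem {k : ℕ} (hk : 1 ≤ k) :
    ∀ g ∈ spaceV a d e k, ∀ h ∈ spaceV a d e k,
      (1 : CoordRing (curve6 a d e)) * (g * h) ∈ CoordLE (curve6 a d e) (2 * k) := by
  have hm : ∀ i j : ℕ, i + j ≤ 2 * k →
      xC a d e ^ i * yC a d e ^ j ∈ CoordLE (curve6 a d e) (2 * k) :=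
    fun i j h => monomial_mem_coordLE a d e h
  have hr : ∀ i j : ℕ, 1 ≤ i → i + j ≤ 2 * k →
      xC a d e ^ i * yC a d e ^ (j + 2) ∈ CoordLE (curve6 a d e) (2 * k) := by
    intro i j hi hij
    obtain ⟨i, rfl⟩ : ∃ i', i = i' + 1 := ⟨i - 1, by omega⟩
    have : xC a d e ^ (i + 1) * yC a d e ^ (j + 2) =
        d • (xC a d e ^ (i + 1) * yC a d e ^ j) + e • (xC a d e ^ i * yC a d e ^ j)
          - a • (xC a d e ^ i * yC a d e ^ (j + 1)) := by
      calc xC a d e ^ (i + 1) * yC a d e ^ (j + 2)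
          = (xC a d e ^ i * yC a d e ^ j) * (xC a d e * yC a d e ^ 2) := by ring
        _ = _ := by
          rw [curve6_relation]
          simp only [Algebra.smul_def]
          ring
    rw [this]
    exact Submodule.sub_mem _ (Submodule.add_mem _ (Submodule.smul_mem _ _ (hm _ _ (by omega)))
      (Submodule.smul_mem _ _ (hm _ _ (by omega)))) (Submodule.smul_mem _ _ (hm _ _ (by omega)))
  have hx : ∀ h ∈ basisBtilde a d e k,
      xC a d e ^ k * yC a d e * h ∈ CoordLE (curve6 a d e) (2 * k) := by
    rintro h (⟨rfl | ⟨i, hi, hik, rfl | rfl⟩ | ⟨j, hj, rfl⟩, hne⟩ | rfl)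
    · exact absurd rfl hne
    · convert hm (k + i) 1 (by omega) using 1; ring
    · convert hr (k + i) 0 (by omega) (by omega) using 1; ring
    · rcases j with _ | j
      · convert hm k 1 (by omega) using 1; ring
      · rcases j with _ | j
        · convert hr k 0 (by omega) (by omega) using 1; ring
        · convert hr k (j + 1) (by omega) (by omega) using 1; ring
    · convert hr (k + k) 0 (by omega) (by omega) using 1; ring
  have hb : ∀ g ∈ basisBtilde a d e k, ∀ h ∈ basisBtilde a d e k,
      g * h ∈ CoordLE (curve6 a d e) (2 * k) := by
    rintro g hg h hh
    rcases hg with hg' | rfl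
    · rcases hh with hh' | rfl
      · exact mul_mem_coordLE (basisB_subset a d e k hg'.1) (basisB_subset a d e k hh'.1)
      · rw [mul_comm g]
        exact hx g (Or.inl hg')
    · exact hx h hh
  intro g hg h hh
  rw [one_mul]
  have := Submodule.mul_mem_mul hg hh
  rw [spaceV, Submodule.span_mul_span] at this
  refine Submodule.span_le.2 ?_ this
  rintro _ ⟨g, hg, h, hh, rfl⟩
  exact hb g hg h hh

end Curve

/-- The `(V^(k), 1)`-localized form of the curve `x y² + a y - d x - e = 0`. -/
def curveLocalForm (a d e : ℝ) {k : ℕ} (hk : 1 ≤ k)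
    (ℓ : CoordLE (curve6 a d e) (2 * k) →ₗ[ℝ] ℝ) : LinearMap.BilinForm ℝ (spaceV a d e k) :=
  localForm ℓ (spaceV a d e k) 1 (spaceV_mul_mem a d e hk)

/-- Nonsingularity of `L` with respect to the curve `C : x y² + a y - d x - e = 0`, for
functionals vanishing on `I_{≤ 2k}`: `ker L̄ = I_{≤ k}`, and the `(V^(k), 1)`-localized form
of `L_C` has trivial kernel. -/
def IsNonsingular (a d e : ℝ) {k : ℕ} (hk : 1 ≤ k) (L : PolyLE (2 * k) →ₗ[ℝ] ℝ)
    (hL : Descends (curve6 a d e) L) : Prop :=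
  formKer (polyForm L) = idealLE (curve6 a d e) k ∧
    formKer (curveLocalForm a d e hk (inducedFunctional (curve6 a d e) L hL)) = ⊥

end

end CubicTMP

/-!
On `C` the coordinate `y` is invertible and `x = e y⁻² - a y⁻¹`, so `F ↦ y^(-2k) F(y)` identifies
`ℝ[C]_{≤ k}` with the polynomials `F` of degree at most `3k` with `F'(0) = c F(0)`, where
`c = -k a / e`, and `V^(k)` with those with `F(0) = 0`. The subspaces `U`, `W` and `Z` become
hyperplanes cut out by the constant and by the leading coefficient, and for a positive semidefinite
form the rank drops to a hyperplane without loss exactly if there is an isotropic vector outside it.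
So the rank conditions provide isotropic polynomials `P` with `P(0) ≠ 0` and `Q` of exact degree
`3k`.

What `L` prescribes is a truncated Hamburger functional `M` of order `6k` with the first moment
left free. Choosing it so that `M(X P) = 0` makes `M` positive semidefinite, and then `Q` forces
`M` to be atomic. The atoms are zeros of `P`, hence nonzero, and so correspond to points of `C`.
Conversely, for a representing measure an isotropic `F` vanishes almost everywhere, and so do the
multiples of `F` divided by a power of `X`; among them there are such `P` and `Q`.
-/

namespace CubicTMP

section HankelForm

variable {A : Type*} [CommRing A] [Algebra ℝ A]

/-- The Hankel form `(f, g) ↦ Λ (f g)` of a functional `Λ` on a subspace `V` of an algebra. -/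
def hankelForm (Λ : A →ₗ[ℝ] ℝ) (V : Submodule ℝ A) : LinearMap.BilinForm ℝ V :=
  LinearMap.BilinForm.restrict ((LinearMap.mul ℝ A).compr₂ Λ) V

variable {Λ : A →ₗ[ℝ] ℝ} {V : Submodule ℝ A}

theorem hankelForm_apply (f g : V) : hankelForm Λ V f g = Λ (f * g) := rfl

theorem hankelForm_isSymm : LinearMap.IsSymm (hankelForm Λ V) :=
  ⟨fun f g => congrArg Λ (mul_comm (f : A) g)⟩

theorem mem_ker_hankelForm_iff (hΛ : ∀ f ∈ V, 0 ≤ Λ (f * f)) {f : V} :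
    f ∈ LinearMap.ker (hankelForm Λ V) ↔ Λ (f * f) = 0 :=
  (LinearMap.BilinForm.apply_apply_same_eq_zero_iff _ (fun g : V => hΛ g g.2)
    hankelForm_isSymm).symm

theorem apply_mul_eq_zero_of_isotropic (hΛ : ∀ f ∈ V, 0 ≤ Λ (f * f)) {f g : A} (hf : f ∈ V)
    (hg : g ∈ V) (hf0 : Λ (f * f) = 0) : Λ (f * g) = 0 :=
  LinearMap.congr_fun ((mem_ker_hankelForm_iff hΛ (f := ⟨f, hf⟩)).2 hf0) (⟨g, hg⟩ : V)

end HankelForm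

section PositiveForms

theorem ker_restrict_of_nonneg {V : Type*} [AddCommGroup V] [Module ℝ V]
    {B : LinearMap.BilinForm ℝ V} (hs : LinearMap.IsSymm B) (hB : ∀ v, 0 ≤ B v v)
    (U : Submodule ℝ V) :
    LinearMap.ker (B.restrict U) = (LinearMap.ker B).comap U.subtype := by
  ext u
  rw [Submodule.mem_comap, ← LinearMap.BilinForm.apply_apply_same_eq_zero_iff B hB hs,
    ← LinearMap.BilinForm.apply_apply_same_eq_zero_iff (B.restrict U) (fun v : U => hB v)
      (hs.domRestrict U)]
  rfl

variable {A V : Type} [CommRing A] [Algebra ℝ A] [AddCommGroup V] [Module ℝ V]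

theorem squarePositive_hankelForm_iff {Λ : A →ₗ[ℝ] ℝ} {V : Submodule ℝ A} :
    SquarePositive (hankelForm Λ V) ↔ ∀ f ∈ V, 0 ≤ Λ (f * f) := by
  refine ⟨fun h f hf => ?_, fun h f _ => h f f.2⟩
  rcases eq_or_ne f 0 with rfl | hf0
  · simp
  · exact h ⟨f, hf⟩ (by simpa using hf0)

theorem formRank_eq_formRank_restrict_iff [FiniteDimensional ℝ V] {B : LinearMap.BilinForm ℝ V}
    (hs : LinearMap.IsSymm B) (hB : ∀ v, 0 ≤ B v v) (U : Submodule ℝ V) :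
    formRank B = formRank (B.restrict U) ↔ U ⊔ LinearMap.ker B = ⊤ := by
  have hrank := LinearMap.finrank_range_add_finrank_ker B
  have hrankU := LinearMap.finrank_range_add_finrank_ker (B.restrict U)
  have hinf : Module.finrank ℝ ((LinearMap.ker B).comap U.subtype) =
      Module.finrank ℝ (U ⊓ LinearMap.ker B : Submodule ℝ V) := by
    rw [← Submodule.map_comap_subtype]
    exact (Submodule.equivMapOfInjective _ U.injective_subtype _).finrank_eq
  rw [ker_restrict_of_nonneg hs hB, hinf] at hrankU
  have hsup := Submodule.finrank_sup_add_finrank_inf_eq U (LinearMap.ker B)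
  rw [formRank, formRank, LinearMap.rank, LinearMap.rank, ← Module.finrank_eq_rank,
    ← Module.finrank_eq_rank, Nat.cast_inj]
  refine ⟨fun h => Submodule.eq_top_of_finrank_eq (by lia), fun h => ?_⟩
  rw [h, finrank_top] at hsup
  lia

theorem formRank_hankelForm_eq_iff {Λ : A →ₗ[ℝ] ℝ} {U V : Submodule ℝ A}
    [FiniteDimensional ℝ V] (hΛ : ∀ f ∈ V, 0 ≤ Λ (f * f)) (hUV : U ⋖ V) :
    formRank (hankelForm Λ V) = formRank (restrictForm (hankelForm Λ V) U) ↔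
      ∃ f ∈ V, f ∉ U ∧ Λ (f * f) = 0 := by
  have hcoatom : IsCoatom (U.submoduleOf V) :=
    isSimpleModule_iff_isCoatom.1 ((covBy_iff_quot_is_simple hUV.le).1 hUV)
  rw [restrictForm, formRank_eq_formRank_restrict_iff hankelForm_isSymm fun f : V => hΛ f f.2,
    ← hcoatom.lt_iff, left_lt_sup, SetLike.not_le_iff_exists]
  exact ⟨fun ⟨f, hf0, hf⟩ => ⟨f, f.2, hf, (mem_ker_hankelForm_iff hΛ).1 hf0⟩,
    fun ⟨f, hfV, hf, hf0⟩ => ⟨⟨f, hfV⟩, (mem_ker_hankelForm_iff hΛ).2 hf0, hf⟩⟩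

variable {M : Type*} [AddCommGroup M] [Module ℝ M]

theorem inf_ker_covBy {S : Submodule ℝ M} {φ : M →ₗ[ℝ] ℝ} {v : M} (hv : v ∈ S) (hφv : φ v ≠ 0) :
    S ⊓ LinearMap.ker φ ⋖ S := by
  have hφ : φ ≠ 0 := fun h => hφv (by rw [h, LinearMap.zero_apply])
  have hker : IsCoatom (LinearMap.ker φ) :=
    LinearMap.isCoatom_ker_of_surjective (LinearMap.surjective hφ)
  refine CovBy.inf_of_sup_right ?_
  rw [(hker.not_le_iff_codisjoint.1 fun h => hφv (h hv)).symm.eq_top]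
  exact hker.covBy_top

theorem formRank_hankelForm_map_eq_iff {Λ : A →ₗ[ℝ] ℝ} {S : Submodule ℝ M}
    [FiniteDimensional ℝ S] {ι : M →ₗ[ℝ] A} (hι : Function.Injective ι)
    (hΛ : ∀ F ∈ S, 0 ≤ Λ (ι F * ι F)) {φ : M →ₗ[ℝ] ℝ} {v : M} (hv : v ∈ S) (hφv : φ v ≠ 0) :
    formRank (hankelForm Λ (S.map ι)) =
        formRank (restrictForm (hankelForm Λ (S.map ι)) ((S ⊓ LinearMap.ker φ).map ι)) ↔
      ∃ F ∈ S, φ F ≠ 0 ∧ Λ (ι F * ι F) = 0 := by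
  rw [formRank_hankelForm_eq_iff (by rintro _ ⟨F, hF, rfl⟩; exact hΛ F hF)
    (Submodule.map_covBy_of_injective hι (inf_ker_covBy hv hφv))]
  have hmem {F : M} (hF : F ∈ S) : ι F ∉ (S ⊓ LinearMap.ker φ).map ι ↔ φ F ≠ 0 := by
    rw [← Submodule.mem_comap, Submodule.comap_map_eq_of_injective hι]
    simp [hF]
  constructor
  · rintro ⟨_, ⟨F, hF, rfl⟩, hFU, hF0⟩
    exact ⟨F, hF, (hmem hF).1 hFU, hF0⟩
  · rintro ⟨F, hF, hFφ, hF0⟩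
    exact ⟨ι F, ⟨F, hF, rfl⟩, (hmem hF).2 hFφ, hF0⟩

end PositiveForms

section RealNullstellensatz

open Polynomial

theorem im_eq_zero_of_aeval_eq_zero {p : ℝ[X]} (hp : p ≠ 0)
    (hreal : ∀ f g, p ∣ f * f + g * g → p ∣ f) {z : ℂ} (hz : aeval z p = 0) : z.im = 0 := by
  by_contra him
  obtain ⟨q, rfl⟩ := quadratic_dvd_of_aeval_eq_zero_im_ne_zero p hz him
  set d : ℝ[X] := X ^ 2 - C (2 * z.re) * X + C (‖z‖ ^ 2) with hd
  have hsum : d = C z.im * C z.im + (X - C z.re) * (X - C z.re) := by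
    rw [hd, Complex.sq_norm, Complex.normSq_apply]
    simp only [map_add, map_mul, C_ofNat]
    ring
  have hdvd : d * q ∣ C z.im * q := hreal _ ((X - C z.re) * q) ⟨q, by rw [hsum]; ring⟩
  have hunit : IsUnit d := isUnit_of_dvd_unit
    ((mul_dvd_mul_iff_right (right_ne_zero_of_mul hp)).1 hdvd) (isUnit_C.2 (IsUnit.mk0 _ him))
  have hdeg : d.natDegree = 2 := by rw [hd]; compute_degree!
  exact two_ne_zero (hdeg.symm.trans (natDegree_eq_zero_of_isUnit hunit))

/-- Real Nullstellensatz in one variable. -/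
theorem exists_finset_mem_iff_eval_eq_zero {I : Ideal ℝ[X]} (hI : I ≠ ⊥)
    (hreal : ∀ f g, f * f + g * g ∈ I → f ∈ I) :
    ∃ S : Finset ℝ, ∀ f, f ∈ I ↔ ∀ s ∈ S, f.eval s = 0 := by
  obtain ⟨p, rfl⟩ : ∃ p, I = Ideal.span {p} := ⟨_, (Ideal.span_singleton_generator I).symm⟩
  have hp : p ≠ 0 := by rintro rfl; simp at hI
  simp only [Ideal.mem_span_singleton] at hreal ⊢
  have hsplits : p.Splits := Splits.of_splits_map (algebraMap ℝ ℂ) (IsAlgClosed.splits _)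
    fun z hz => ⟨z.re, Complex.ext rfl
      (im_eq_zero_of_aeval_eq_zero hp hreal ((mem_aroots.1 hz).2)).symm⟩
  have hsqfree : Squarefree p := (isRadical_iff_squarefree_of_ne_zero hp).1
    (isRadical_iff_pow_one_lt 2 one_lt_two |>.2 fun f hf => hreal f 0 (by simpa [sq] using hf))
  refine ⟨p.roots.toFinset, fun f => ?_⟩
  rcases eq_or_ne f 0 with rfl | hf
  · simp
  rw [hsplits.dvd_iff_roots_le_roots hp hf,
    Multiset.le_iff_subset (nodup_roots (PerfectField.separable_iff_squarefree.2 hsqfree))]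
  simp [Multiset.subset_iff, hf]

end RealNullstellensatz

section Hamburger

open Polynomial

/-- The radical of the bilinear form `(f, g) ↦ Λ (f g)` on `ℝ[X]`; it is an ideal because the form
is invariant under multiplication. -/
def radicalIdeal (Λ : ℝ[X] →ₗ[ℝ] ℝ) : Ideal ℝ[X] where
  carrier := {f | ∀ g, Λ (f * g) = 0}
  zero_mem' := by simp
  add_mem' hf hg h := by rw [add_mul, map_add, hf, hg, add_zero]
  smul_mem' r f hf g := by rw [smul_eq_mul, mul_comm r, mul_assoc, hf]

theorem mem_radicalIdeal_iff {Λ : ℝ[X] →ₗ[ℝ] ℝ} (hΛ : ∀ f, 0 ≤ Λ (f * f)) {f : ℝ[X]} :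
    f ∈ radicalIdeal Λ ↔ Λ (f * f) = 0 :=
  ⟨fun hf => hf f, fun hf _ => apply_mul_eq_zero_of_isotropic (V := ⊤) (fun f _ => hΛ f)
    Submodule.mem_top Submodule.mem_top hf⟩

theorem exists_atomic_of_radicalIdeal_ne_bot {Λ : ℝ[X] →ₗ[ℝ] ℝ} (hΛ : ∀ f, 0 ≤ Λ (f * f))
    (hrad : radicalIdeal Λ ≠ ⊥) :
    ∃ (S : Finset ℝ) (w : ℝ → ℝ), (∀ s ∈ S, 0 < w s) ∧ ∀ f, Λ f = ∑ s ∈ S, w s * f.eval s := by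
  obtain ⟨S, hS⟩ := exists_finset_mem_iff_eval_eq_zero hrad fun f g hfg => by
    rw [mem_radicalIdeal_iff hΛ]
    have hsum : Λ (f * f) + Λ (g * g) = 0 := by simpa using hfg 1
    linarith [hΛ f, hΛ g]
  let b (s : ℝ) : ℝ[X] := Lagrange.basis S id s
  have hrep (f : ℝ[X]) : Λ f = ∑ s ∈ S, Λ (b s) * f.eval s := by
    have hinterp : f - Lagrange.interpolate S id (fun s => f.eval s) ∈ radicalIdeal Λ :=
      (hS _).2 fun s hs => by
        rw [eval_sub, sub_eq_zero]
        exact (Lagrange.eval_interpolate_at_node (fun s => f.eval s)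
          Function.injective_id.injOn hs).symm
    have hΛf := hinterp 1
    rw [mul_one, map_sub, sub_eq_zero] at hΛf
    rw [hΛf, Lagrange.interpolate_apply, map_sum]
    exact Finset.sum_congr rfl fun s _ => by
      rw [← smul_eq_C_mul, map_smul, smul_eq_mul, mul_comm]
  have hb_self {s : ℝ} (hs : s ∈ S) : (b s).eval s = 1 :=
    Lagrange.eval_basis_self Function.injective_id.injOn hs
  refine ⟨S, fun s => Λ (b s), fun s hs => ?_, hrep⟩
  have hsq : Λ (b s) = Λ (b s * b s) := by
    rw [hrep (b s * b s), Finset.sum_eq_single_of_mem s hs, eval_mul, hb_self hs, mul_one, mul_one]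
    intro r hr hrs
    rw [eval_mul, show (b s).eval r = 0 from Lagrange.eval_basis_of_ne (v := id) hrs.symm hr,
      mul_zero, mul_zero]
  refine ((hΛ _).lt_of_ne' fun hzero => one_ne_zero ((hb_self hs).symm.trans ?_)).trans_eq hsq.symm
  exact (hS _).1 ((mem_radicalIdeal_iff hΛ).2 hzero) s hs

/-- The singular truncated Hamburger moment problem. The functional `f ↦ M (f %ₘ Q)` is positive on
all squares, agrees with `M` up to degree `2 n`, and has `Q` in its radical. -/
theorem exists_atomic_of_monic_isotropic {n : ℕ} {M : ℝ[X] →ₗ[ℝ] ℝ}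
    (hM : ∀ f : ℝ[X], f.natDegree ≤ n → 0 ≤ M (f * f)) {Q : ℝ[X]} (hQ : Q.Monic)
    (hQn : Q.natDegree = n) (hQ0 : M (Q * Q) = 0) :
    ∃ (S : Finset ℝ) (w : ℝ → ℝ), (∀ s ∈ S, 0 < w s) ∧
      ∀ f : ℝ[X], f.natDegree ≤ 2 * n → M f = ∑ s ∈ S, w s * f.eval s := by
  have hmem {f : ℝ[X]} : f ∈ degreeLE ℝ n ↔ f.natDegree ≤ n :=
    mem_degreeLE.trans natDegree_le_iff_degree_le.symm
  have hrem (f : ℝ[X]) : (f %ₘ Q).natDegree ≤ n := hQn ▸ natDegree_modByMonic_le f hQ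
  have hmod {f : ℝ[X]} (hf : f.natDegree ≤ 2 * n) : M (f %ₘ Q) = M f := by
    conv_rhs => rw [← modByMonic_add_div f Q, map_add]
    rw [apply_mul_eq_zero_of_isotropic (V := degreeLE ℝ n) (fun g hg => hM g (hmem.1 hg))
      (hmem.2 hQn.le) (hmem.2 _) hQ0, add_zero]
    rw [natDegree_divByMonic f hQ]
    lia
  let Λ : ℝ[X] →ₗ[ℝ] ℝ := M.comp (modByMonicHom Q)
  have hΛ (f : ℝ[X]) : 0 ≤ Λ (f * f) := by
    change 0 ≤ M ((f * f) %ₘ Q)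
    rw [mul_modByMonic, hmod (natDegree_mul_le.trans (by have := hrem f; lia))]
    exact hM _ (hrem f)
  have hQΛ : Q ∈ radicalIdeal Λ := fun g =>
    (congrArg M ((modByMonic_eq_zero_iff_dvd hQ).2 (dvd_mul_right Q g))).trans (map_zero M)
  obtain ⟨S, w, hw, hrep⟩ :=
    exists_atomic_of_radicalIdeal_ne_bot hΛ ((Submodule.ne_bot_iff _).2 ⟨Q, hQΛ, hQ.ne_zero⟩)
  exact ⟨S, w, hw, fun f hf => (hmod hf).symm.trans (hrep f)⟩

theorem exists_atomic_of_isotropic {n : ℕ} {M : ℝ[X] →ₗ[ℝ] ℝ}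
    (hM : ∀ f : ℝ[X], f.natDegree ≤ n → 0 ≤ M (f * f)) {Q : ℝ[X]} (hQ : Q ≠ 0)
    (hQn : Q.natDegree = n) (hQ0 : M (Q * Q) = 0) :
    ∃ (S : Finset ℝ) (w : ℝ → ℝ), (∀ s ∈ S, 0 < w s) ∧
      ∀ f : ℝ[X], f.natDegree ≤ 2 * n → M f = ∑ s ∈ S, w s * f.eval s := by
  refine exists_atomic_of_monic_isotropic hM (monic_mul_leadingCoeff_inv hQ)
    (natDegree_mul_leadingCoeff_inv Q hQ ▸ hQn) ?_
  rw [mul_mul_mul_comm, mul_comm, ← C_mul, ← smul_eq_C_mul, map_smul, hQ0, smul_zero]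

theorem eval_eq_zero_of_sum_sq_eq_zero {S : Finset ℝ} {w : ℝ → ℝ} (hw : ∀ s ∈ S, 0 < w s)
    {P : ℝ[X]} (hP : ∑ s ∈ S, w s * (P * P).eval s = 0) {s : ℝ} (hs : s ∈ S) : P.eval s = 0 := by
  have hterm (r : ℝ) (hr : r ∈ S) : 0 ≤ w r * (P * P).eval r :=
    mul_nonneg (hw r hr).le (eval_mul (R := ℝ) ▸ mul_self_nonneg _)
  simpa [(hw s hs).ne'] using (Finset.sum_eq_zero_iff_of_nonneg hterm).1 hP s hs

end Hamburger

section CoefficientSpaces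

open Polynomial

/-- The real polynomials all of whose monomials have exponents in `[p, q]`. -/
noncomputable def coeffIcc (p q : ℕ) : Submodule ℝ ℝ[X] where
  carrier := {F | ∀ i ∉ Set.Icc p q, F.coeff i = 0}
  zero_mem' := by simp
  add_mem' hF hG i hi := by rw [coeff_add, hF i hi, hG i hi, add_zero]
  smul_mem' r F hF i hi := by rw [coeff_smul, hF i hi, smul_zero]

/-- The real polynomials of degree at most `q` whose `1`-jet at the origin is proportional to
`1 + c X`. -/
noncomputable def jetSpace (c : ℝ) (q : ℕ) : Submodule ℝ ℝ[X] :=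
  coeffIcc 0 q ⊓ LinearMap.ker (lcoeff ℝ 1 - c • lcoeff ℝ 0)

variable {p q n : ℕ} {c : ℝ} {E F G : ℝ[X]}

theorem mem_coeffIcc_zero : F ∈ coeffIcc 0 q ↔ F.natDegree ≤ q := by
  rw [natDegree_le_iff_coeff_eq_zero]
  exact forall_congr' fun i => by simp

theorem natDegree_le_of_mem_coeffIcc (hF : F ∈ coeffIcc p q) : F.natDegree ≤ q :=
  natDegree_le_iff_coeff_eq_zero.2 fun i hi => hF i fun h => hi.not_ge h.2

theorem coeffIcc_mono {p' q' : ℕ} (hp : p' ≤ p) (hq : q ≤ q') : coeffIcc p q ≤ coeffIcc p' q' :=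
  fun _ hF i hi => hF i fun h => hi ⟨hp.trans h.1, h.2.trans hq⟩

theorem mem_coeffIcc_succ (hF : F ∈ coeffIcc p q) (hFp : F.coeff p = 0) :
    F ∈ coeffIcc (p + 1) q := fun i hi => by
  rcases eq_or_ne i p with rfl | hip
  · exact hFp
  · exact hF i fun h => hi ⟨h.1.lt_of_ne' hip, h.2⟩

theorem mem_jetSpace : F ∈ jetSpace c q ↔ F.natDegree ≤ q ∧ F.coeff 1 = c * F.coeff 0 := by
  simp [jetSpace, mem_coeffIcc_zero, sub_eq_zero]

theorem natDegree_le_of_mem_jetSpace_or_mem_coeffIcc (hF : F ∈ jetSpace c q ∨ F ∈ coeffIcc p q) :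
    F.natDegree ≤ q :=
  hF.elim (fun h => (mem_jetSpace.1 h).1) natDegree_le_of_mem_coeffIcc

theorem coeffIcc_two_le_jetSpace : coeffIcc 2 q ≤ jetSpace c q := fun F hF =>
  mem_jetSpace.2 ⟨natDegree_le_of_mem_coeffIcc hF, by
    rw [hF 1 (by simp), hF 0 (by simp), mul_zero]⟩

theorem mul_mem_jetSpace (hF : F ∈ jetSpace c n) (hG : G ∈ jetSpace c n) :
    F * G ∈ jetSpace (2 * c) (2 * n) := by
  rw [mem_jetSpace] at *
  refine ⟨natDegree_mul_le.trans (by lia), ?_⟩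
  rw [mul_coeff_one, mul_coeff_zero, hF.2, hG.2]
  ring

theorem mul_mem_jetSpace_of_mem_coeffIcc (hF : F ∈ coeffIcc 1 n) (hG : G ∈ coeffIcc 1 n) :
    F * G ∈ jetSpace (2 * c) (2 * n) := by
  rw [mem_jetSpace, mul_coeff_one, mul_coeff_zero, hF 0 (by simp), hG 0 (by simp)]
  have := natDegree_le_of_mem_coeffIcc hF
  have := natDegree_le_of_mem_coeffIcc hG
  exact ⟨natDegree_mul_le.trans (by lia), by ring⟩

theorem span_image_eq_coeffIcc {E : ℕ → ℝ[X]} (hE : ∀ j ∈ Set.Icc p q, E j ∈ coeffIcc j q)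
    (hE0 : ∀ j ∈ Set.Icc p q, (E j).coeff j ≠ 0) :
    Submodule.span ℝ (E '' Set.Icc p q) = coeffIcc p q := by
  refine le_antisymm (Submodule.span_le.2 ?_) ?_
  · rintro _ ⟨j, hj, rfl⟩
    exact coeffIcc_mono hj.1 le_rfl (hE j hj)
  induction h : q + 1 - p generalizing p with
  | zero =>
    intro F hF
    rw [show F = 0 from ext fun i => hF i (by simp; lia)]
    exact zero_mem _
  | succ m ih =>
    intro F hF
    have hp : p ∈ Set.Icc p q := ⟨le_rfl, by lia⟩
    have hsub : Set.Icc (p + 1) q ⊆ Set.Icc p q := Set.Icc_subset_Icc_left p.le_succ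
    set r : ℝ := F.coeff p / (E p).coeff p
    have hrest : F - r • E p ∈ coeffIcc (p + 1) q :=
      mem_coeffIcc_succ (sub_mem hF (Submodule.smul_mem _ r (hE p hp)))
        (by simp [r, hE0 p hp])
    rw [← sub_add_cancel F (r • E p)]
    refine add_mem (Submodule.span_mono (Set.image_mono hsub) ?_)
      (Submodule.smul_mem _ _ (Submodule.subset_span ⟨p, hp, rfl⟩))
    exact ih (fun j hj => hE j (hsub hj)) (fun j hj => hE0 j (hsub hj)) (by lia) hrest

theorem X_pow_mem_coeffIcc {j : ℕ} (hp : p ≤ j) (hq : j ≤ q) : (X ^ j : ℝ[X]) ∈ coeffIcc p q :=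
  fun i hi => by
    rw [coeff_X_pow, if_neg]
    rintro rfl
    exact hi ⟨hp, hq⟩

instance : FiniteDimensional ℝ (coeffIcc p q) := by
  rw [← span_image_eq_coeffIcc (E := fun j => X ^ j)]
  · exact FiniteDimensional.span_of_finite ℝ ((Set.finite_Icc p q).image _)
  · exact fun j hj => X_pow_mem_coeffIcc le_rfl hj.2
  · simp

instance : FiniteDimensional ℝ (jetSpace c q) :=
  Submodule.finiteDimensional_inf_left _ _

theorem coeffIcc_inf_ker_lcoeff (hn : n ≠ 0) :
    coeffIcc p n ⊓ LinearMap.ker (lcoeff ℝ n) = coeffIcc p (n - 1) := by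
  ext F
  refine ⟨fun ⟨hF, hFn⟩ i hi => ?_, fun hF => ⟨coeffIcc_mono le_rfl n.pred_le hF, hF n ?_⟩⟩
  · rcases eq_or_ne i n with rfl | hin
    · exact hFn
    · exact hF i fun h => hi ⟨h.1, by have := h.2; lia⟩
  · exact fun h => by have := h.2; lia

theorem jetSpace_inf_ker_lcoeff (hn : n ≠ 0) :
    jetSpace c n ⊓ LinearMap.ker (lcoeff ℝ n) = jetSpace c (n - 1) := by
  rw [jetSpace, inf_right_comm, coeffIcc_inf_ker_lcoeff hn, ← jetSpace]

theorem jetSpace_inf_ker_lcoeff_zero :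
    jetSpace c n ⊓ LinearMap.ker (lcoeff ℝ 0) = coeffIcc 2 n := by
  ext F
  constructor
  · rintro ⟨hF, hF0⟩
    have hF0 : F.coeff 0 = 0 := hF0
    exact mem_coeffIcc_succ (mem_coeffIcc_succ hF.1 hF0)
      (by rw [(mem_jetSpace.1 hF).2, hF0, mul_zero])
  · exact fun hF => ⟨coeffIcc_two_le_jetSpace hF, hF 0 (by simp)⟩

theorem jetSpace_eq_span_singleton_sup (hE : E ∈ jetSpace c n) (hE0 : E.coeff 0 ≠ 0) :
    jetSpace c n = Submodule.span ℝ {E} ⊔ coeffIcc 2 n := by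
  refine le_antisymm (fun F hF => ?_)
    (sup_le ((Submodule.span_singleton_le_iff_mem _ _).2 hE) coeffIcc_two_le_jetSpace)
  set r : ℝ := F.coeff 0 / E.coeff 0
  rw [← add_sub_cancel (r • E) F]
  refine Submodule.add_mem_sup (Submodule.mem_span_singleton.2 ⟨r, rfl⟩) ?_
  rw [← jetSpace_inf_ker_lcoeff_zero]
  exact ⟨sub_mem hF (Submodule.smul_mem _ r hE), by simp [r, hE0]⟩

theorem exists_mem_jetSpace_dvd (c : ℝ) (hF0 : F.coeff 0 ≠ 0) (hF : F.natDegree < n) :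
    ∃ G ∈ jetSpace c n, G.coeff 0 ≠ 0 ∧ F ∣ G := by
  refine ⟨(C (F.coeff 0) + C (c * F.coeff 0 - F.coeff 1) * X) * F, mem_jetSpace.2 ⟨?_, ?_⟩, ?_,
    dvd_mul_left _ _⟩
  · have : (C (F.coeff 0) + C (c * F.coeff 0 - F.coeff 1) * X).natDegree ≤ 1 := by
      compute_degree
    exact natDegree_mul_le.trans (by lia)
  · simp only [mul_coeff_one, mul_coeff_zero, coeff_add, coeff_C_zero, coeff_X_zero,
      coeff_C_of_ne_zero one_ne_zero, coeff_X_one]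
    ring
  · simp [hF0]

theorem exists_mem_jetSpace_dvd_X_pow_mul (hF : F ∈ jetSpace c n ∨ F ∈ coeffIcc 1 n)
    (hF0 : F ≠ 0) : ∃ G ∈ jetSpace c n, G.coeff 0 ≠ 0 ∧ ∃ j, F ∣ X ^ j * G := by
  by_cases hzero : F.coeff 0 = 0
  · obtain ⟨H, hFH, hH⟩ := exists_eq_pow_rootMultiplicity_mul_and_not_dvd F hF0 0
    have hm : 0 < F.rootMultiplicity 0 :=
      (rootMultiplicity_pos hF0).2 (by rwa [IsRoot, ← coeff_zero_eq_eval_zero])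
    rw [C_0, sub_zero] at hFH hH
    have hH0 : H.coeff 0 ≠ 0 := mt X_dvd_iff.2 hH
    have hdeg : H.natDegree < n := by
      have hFn := natDegree_le_of_mem_jetSpace_or_mem_coeffIcc hF
      rw [hFH, natDegree_X_pow_mul _ (by rintro rfl; exact hH0 (coeff_zero 0))] at hFn
      lia
    obtain ⟨G, hG, hG0, hHG⟩ := exists_mem_jetSpace_dvd c hH0 hdeg
    exact ⟨G, hG, hG0, F.rootMultiplicity 0, by nth_rw 1 [hFH]; exact mul_dvd_mul_left _ hHG⟩
  · refine ⟨F, hF.resolve_right fun h => hzero (h 0 (by simp)), hzero, 0, ?_⟩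
    rw [pow_zero, one_mul]

theorem exists_coeff_top_ne_zero_dvd (hF : F ∈ jetSpace c n ∨ F ∈ coeffIcc 1 n) (hF0 : F ≠ 0) :
    ∃ G, (G ∈ jetSpace c n ∨ G ∈ coeffIcc 1 n) ∧ G.coeff n ≠ 0 ∧ F ∣ G := by
  obtain ⟨m, rfl⟩ :=
    Nat.exists_eq_add_of_le (natDegree_le_of_mem_jetSpace_or_mem_coeffIcc hF)
  rcases eq_or_ne m 0 with rfl | hm
  · exact ⟨F, hF, by simpa using hF0, dvd_rfl⟩
  refine ⟨X ^ m * F, .inr fun i hi => ?_, by simpa [coeff_X_pow_mul] using hF0, dvd_mul_left _ _⟩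
  rw [coeff_X_pow_mul', ite_eq_right_iff]
  refine fun hmi => coeff_eq_zero_of_natDegree_lt ?_
  have : ¬ i ≤ F.natDegree + m := fun h => hi ⟨by lia, h⟩
  lia

end CoefficientSpaces

section GapProblem

open Polynomial

variable {n : ℕ} {c : ℝ} {M : ℝ[X] →ₗ[ℝ] ℝ} {P : ℝ[X]}

theorem exists_eqOn_jetSpace_apply_X_mul_eq_zero (c : ℝ) (q : ℕ) (M : ℝ[X] →ₗ[ℝ] ℝ)
    (hP : P.coeff 0 ≠ 0) :
    ∃ N : ℝ[X] →ₗ[ℝ] ℝ, (∀ F ∈ jetSpace c q, N F = M F) ∧ N (X * P) = 0 := by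
  refine ⟨M - (M (X * P) / P.coeff 0) • (lcoeff ℝ 1 - c • lcoeff ℝ 0), fun F hF => ?_, ?_⟩
  · rw [LinearMap.sub_apply, LinearMap.smul_apply, LinearMap.mem_ker.1 hF.2, smul_zero, sub_zero]
  · simp [hP]

/-- Any `F` of degree at most `n` is `r P + X G`, and `P` is orthogonal to `X` and to the
polynomials without constant and linear term, hence to `X G`. -/
theorem apply_sq_nonneg_of_apply_X_mul_eq_zero (hjet : ∀ F ∈ jetSpace c n, 0 ≤ M (F * F))
    (htail : ∀ F ∈ coeffIcc 1 n, 0 ≤ M (F * F)) (hP : P ∈ jetSpace c n) (hP0 : P.coeff 0 ≠ 0)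
    (hPP : M (P * P) = 0) (hXP : M (X * P) = 0) {F : ℝ[X]} (hF : F.natDegree ≤ n) :
    0 ≤ M (F * F) := by
  set r : ℝ := F.coeff 0 / P.coeff 0
  set G : ℝ[X] := F - r • P with hG
  have hGmem : G ∈ coeffIcc 1 n :=
    mem_coeffIcc_succ (sub_mem (mem_coeffIcc_zero.2 hF) (Submodule.smul_mem _ r hP.1))
      (by simp [hG, r, hP0])
  have hPG : M (P * G) = 0 := by
    have hG2 : G - G.coeff 1 • X ∈ jetSpace c n := coeffIcc_two_le_jetSpace fun i hi => by
      rcases eq_or_ne i 1 with rfl | hi1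
      · simp
      · rw [coeff_sub, coeff_smul, coeff_X_of_ne_one hi1, hGmem i fun h => hi ?_]
        · simp
        · exact ⟨h.1.lt_of_ne' hi1, h.2⟩
    have h := apply_mul_eq_zero_of_isotropic hjet hP hG2 hPP
    rwa [mul_sub, mul_smul_comm, mul_comm P X, map_sub, map_smul, hXP, smul_zero, sub_zero] at h
  have hFF : F * F = (r * r) • (P * P) + (2 * r) • (P * G) + G * G := by
    rw [show F = r • P + G by rw [hG]; abel]
    simp only [smul_eq_C_mul, map_mul, C_ofNat]
    ring
  rw [hFF, map_add, map_add, map_smul, map_smul, hPP, hPG, smul_zero, smul_zero, zero_add,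
    zero_add]
  exact htail G hGmem

/-- Positivity and flatness of a functional `M` whose values are only prescribed on
`jetSpace (2 * c) (2 * n)`, so that one moment is missing: `M` is nonnegative on the squares from
`jetSpace c n` and `coeffIcc 1 n`, and among these there are isotropic polynomials with nonzero
constant term and with exact degree `n`. -/
structure IsFlatGapFunctional (M : ℝ[X] →ₗ[ℝ] ℝ) (c : ℝ) (n : ℕ) : Prop where
  jet_nonneg : ∀ F ∈ jetSpace c n, 0 ≤ M (F * F)
  tail_nonneg : ∀ F ∈ coeffIcc 1 n, 0 ≤ M (F * F)
  exists_isotropic_coeff_zero : ∃ P ∈ jetSpace c n, P.coeff 0 ≠ 0 ∧ M (P * P) = 0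
  exists_isotropic_coeff_top :
    ∃ Q, (Q ∈ jetSpace c n ∨ Q ∈ coeffIcc 1 n) ∧ Q.coeff n ≠ 0 ∧ M (Q * Q) = 0

theorem isFlatGapFunctional_iff : IsFlatGapFunctional M c n ↔
    (∀ F ∈ jetSpace c n, 0 ≤ M (F * F)) ∧ (∀ F ∈ coeffIcc 1 n, 0 ≤ M (F * F)) ∧
      (∃ P ∈ jetSpace c n, P.coeff 0 ≠ 0 ∧ M (P * P) = 0) ∧
      ((∃ Q ∈ jetSpace c n, Q.coeff n ≠ 0 ∧ M (Q * Q) = 0) ∨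
        ∃ Q ∈ coeffIcc 1 n, Q.coeff n ≠ 0 ∧ M (Q * Q) = 0) := by
  simp only [← exists_or, ← or_and_right]
  exact ⟨fun ⟨hjet, htail, hP, hQ⟩ => ⟨hjet, htail, hP, hQ⟩,
    fun ⟨hjet, htail, hP, hQ⟩ => ⟨hjet, htail, hP, hQ⟩⟩

theorem IsFlatGapFunctional.exists_atomic (hM : IsFlatGapFunctional M c n) :
    ∃ (S : Finset ℝ) (w : ℝ → ℝ), (∀ s ∈ S, s ≠ 0 ∧ 0 < w s) ∧
      ∀ F ∈ jetSpace (2 * c) (2 * n), M F = ∑ s ∈ S, w s * F.eval s := by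
  obtain ⟨hjet, htail, ⟨P, hP, hP0, hPP⟩, Q, hQ, hQn, hQQ⟩ := hM
  obtain ⟨N, hNM, hXP⟩ := exists_eqOn_jetSpace_apply_X_mul_eq_zero (2 * c) (2 * n) M hP0
  have hNjet {F : ℝ[X]} (hF : F ∈ jetSpace c n) : N (F * F) = M (F * F) :=
    hNM _ (mul_mem_jetSpace hF hF)
  have hNtail {F : ℝ[X]} (hF : F ∈ coeffIcc 1 n) : N (F * F) = M (F * F) :=
    hNM _ (mul_mem_jetSpace_of_mem_coeffIcc hF hF)
  have hNPP : N (P * P) = 0 := (hNjet hP).trans hPP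
  have hNQQ : N (Q * Q) = 0 := (hQ.elim hNjet hNtail).trans hQQ
  have hN (F : ℝ[X]) (hF : F.natDegree ≤ n) : 0 ≤ N (F * F) :=
    apply_sq_nonneg_of_apply_X_mul_eq_zero (fun F hF => hNjet hF ▸ hjet F hF)
      (fun F hF => hNtail hF ▸ htail F hF) hP hP0 hNPP hXP hF
  have hQdeg : Q.natDegree = n :=
    (natDegree_le_of_mem_jetSpace_or_mem_coeffIcc hQ).antisymm (le_natDegree_of_ne_zero hQn)
  obtain ⟨S, w, hw, hrep⟩ := exists_atomic_of_isotropic hN (by rintro rfl; simp at hQn) hQdeg hNQQ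
  refine ⟨S, w, fun s hs => ⟨?_, hw s hs⟩, fun F hF =>
    (hNM F hF).symm.trans (hrep F (mem_jetSpace.1 hF).1)⟩
  have hPs : P.eval s = 0 := eval_eq_zero_of_sum_sq_eq_zero hw
    (hrep (P * P) (mem_jetSpace.1 (mul_mem_jetSpace hP hP)).1 ▸ hNPP) hs
  rintro rfl
  exact hP0 (coeff_zero_eq_eval_zero P ▸ hPs)

end GapProblem

section Evaluation

variable {K : Set (Fin 2 → ℝ)} {z : Fin 2 → ℝ}

/-- The value of an element of `ℝ[K]` at a point of `K`. -/
noncomputable def evalAt (z : Fin 2 → ℝ) (hz : z ∈ K) : CoordRing K →ₐ[ℝ] ℝ :=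
  Ideal.Quotient.liftₐ (MvPolynomial.vanishingIdeal ℝ K) (MvPolynomial.aeval z)
    fun _ hp => MvPolynomial.mem_vanishingIdeal_iff.1 hp z hz

theorem evalAt_toCoord (hz : z ∈ K) (p : Poly) :
    evalAt z hz (toCoord K p) = MvPolynomial.eval z p :=
  rfl

end Evaluation

section Parametrization

open Polynomial

theorem ne_zero_of_irreducible {a e : ℝ} (h : Irreducible (P6 a 0 e)) : e ≠ 0 := by
  rintro rfl
  have hfactor : P6 a 0 0 = MvPolynomial.X 1 *
      (MvPolynomial.X 0 * MvPolynomial.X 1 + MvPolynomial.C a) := by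
    simp only [P6, map_zero]
    ring
  rcases h.isUnit_or_isUnit hfactor with hunit | hunit
  · simpa using hunit.map (MvPolynomial.eval (0 : Fin 2 → ℝ))
  · simpa using hunit.map (MvPolynomial.eval (![-a, 1] : Fin 2 → ℝ))

variable {a e t : ℝ} {k m : ℕ}

local notation "R" => CoordRing (curve6 a 0 e)
local notation "x" => xC a 0 e
local notation "y" => yC a 0 e

/-- The point of the curve `x y² + a y = e` with second coordinate `t ≠ 0`. -/
noncomputable def curvePoint (a e t : ℝ) : Fin 2 → ℝ := ![e / t ^ 2 - a / t, t]

theorem curvePoint_mem (ht : t ≠ 0) : curvePoint a e t ∈ curve6 a 0 e := by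
  simp only [curve6, zeroSet, P6, curvePoint, Set.mem_ofPred_eq, map_sub, map_add, map_mul,
    map_pow, MvPolynomial.eval_X, MvPolynomial.eval_C, Matrix.cons_val_zero, Matrix.cons_val_one]
  field_simp
  ring

/-- The inverse of `y` in `ℝ[C]`, as read off from `y (x y + a) = e`. -/
noncomputable def yInv (a e : ℝ) : CoordRing (curve6 a 0 e) :=
  algebraMap ℝ _ e⁻¹ * (xC a 0 e * yC a 0 e + algebraMap ℝ _ a)

theorem x_mul_y_sq : x * y ^ 2 = algebraMap ℝ R e - algebraMap ℝ R a * y := by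
  rw [curve6_relation, zero_smul, zero_add, Algebra.smul_def, Algebra.smul_def, mul_one]

theorem y_mul_yInv (he : e ≠ 0) : y * yInv a e = 1 := by
  have h : algebraMap ℝ R e⁻¹ * algebraMap ℝ R e = 1 := by
    rw [← map_mul, inv_mul_cancel₀ he, map_one]
  rw [yInv]
  linear_combination algebraMap ℝ R e⁻¹ * x_mul_y_sq (a := a) (e := e) + h

theorem evalAt_y (ht : t ≠ 0) : evalAt (curvePoint a e t) (curvePoint_mem ht) y = t := by
  rw [yC, evalAt_toCoord, MvPolynomial.eval_X]
  rfl

theorem evalAt_yInv (ht : t ≠ 0) (he : e ≠ 0) :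
    evalAt (curvePoint a e t) (curvePoint_mem ht) (yInv a e) = t⁻¹ := by
  have h := congrArg (evalAt (curvePoint a e t) (curvePoint_mem ht)) (y_mul_yInv (a := a) he)
  rw [map_mul, map_one, evalAt_y ht] at h
  exact eq_inv_of_mul_eq_one_right h

/-- The linear map `F ↦ y^(-2m) F(y)` from `ℝ[X]` to `ℝ[C]`. -/
noncomputable def ofPoly (a e : ℝ) (m : ℕ) : ℝ[X] →ₗ[ℝ] CoordRing (curve6 a 0 e) :=
  LinearMap.mulLeft ℝ (yInv a e ^ (2 * m)) ∘ₗ (aeval (yC a 0 e)).toLinearMap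

theorem ofPoly_apply (m : ℕ) (F : ℝ[X]) : ofPoly a e m F = yInv a e ^ (2 * m) * aeval y F :=
  rfl

theorem ofPoly_mul_ofPoly (k : ℕ) (F G : ℝ[X]) :
    ofPoly a e k F * ofPoly a e k G = ofPoly a e (2 * k) (F * G) := by
  simp only [ofPoly_apply, map_mul]
  ring

theorem evalAt_ofPoly (ht : t ≠ 0) (he : e ≠ 0) (m : ℕ) (F : ℝ[X]) :
    evalAt (curvePoint a e t) (curvePoint_mem ht) (ofPoly a e m F) =
      (t ^ (2 * m))⁻¹ * F.eval t := by
  rw [ofPoly_apply, map_mul, map_pow, evalAt_yInv ht he, ← aeval_algHom_apply, evalAt_y ht,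
    coe_aeval_eq_eval, inv_pow]

theorem ofPoly_injective (he : e ≠ 0) (m : ℕ) : Function.Injective (ofPoly a e m) := by
  rw [← LinearMap.ker_eq_bot, LinearMap.ker_eq_bot']
  intro F hF
  refine eq_zero_of_infinite_isRoot F
    ((Set.finite_singleton (0 : ℝ)).infinite_compl.mono fun t ht => ?_)
  have ht : t ≠ 0 := ht
  have h := evalAt_ofPoly (a := a) ht he m F
  rw [hF, map_zero] at h
  exact (mul_eq_zero.1 h.symm).resolve_left (inv_ne_zero (pow_ne_zero _ ht))

theorem ofPoly_dvd_ofPoly (he : e ≠ 0) {F G : ℝ[X]} {j : ℕ} (h : F ∣ X ^ j * G) :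
    ofPoly a e k F ∣ ofPoly a e k G := by
  obtain ⟨H, hH⟩ := h
  have hy : (y * yInv a e) ^ j = 1 := by rw [y_mul_yInv he, one_pow]
  have hH := congrArg (aeval y) hH
  rw [map_mul, map_mul, map_pow, aeval_X] at hH
  refine ⟨yInv a e ^ j * aeval y H, ?_⟩
  rw [ofPoly_apply, ofPoly_apply]
  linear_combination yInv a e ^ (2 * k) * (yInv a e ^ j * hH - aeval y G * hy)

theorem x_pow_mul_y_pow (he : e ≠ 0) {i : ℕ} (hi : i ≤ m) (j : ℕ) :
    x ^ i * y ^ j = ofPoly a e m ((C e - C a * X) ^ i * X ^ (2 * (m - i) + j)) := by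
  obtain ⟨n, rfl⟩ := Nat.exists_eq_add_of_le hi
  have hx : aeval y (C e - C a * X) = x * y ^ 2 := by
    rw [x_mul_y_sq, map_sub, map_mul, aeval_C, aeval_C, aeval_X]
  have hy : (y * yInv a e) ^ (2 * (i + n)) = 1 := by rw [y_mul_yInv he, one_pow]
  rw [ofPoly_apply, map_mul, map_pow, hx, map_pow, aeval_X, Nat.add_sub_cancel_left]
  linear_combination (-(x ^ i * y ^ j)) * hy

end Parametrization

section Bases

open Polynomial

/-- The polynomial `F` with `y^(-2k) F(y)` equal to the `j`-th term of the sequence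
`x^k, x^k y, x^(k-1), x^(k-1) y, …, x, x y, 1, y, …, y^k`; the index `j` is the order of vanishing
of `F` at the origin. -/
noncomputable def basisPoly (a e : ℝ) (k j : ℕ) : ℝ[X] := (C e - C a * X) ^ (k - j / 2) * X ^ j

/-- The ratio `F'(0) / F(0)` for those `F` with `F(0) ≠ 0` such that `y^(-2m) F(y)` lies in
`ℝ[C]_{≤ m}`. -/
noncomputable def jetRatio (a e : ℝ) (m : ℕ) : ℝ := -(m * a) / e

variable {a e : ℝ} {k m p q : ℕ}

local notation "x" => xC a 0 e
local notation "y" => yC a 0 e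

theorem jetRatio_two_mul : jetRatio a e (2 * k) = 2 * jetRatio a e k := by
  rw [jetRatio, jetRatio]
  push_cast
  ring

theorem natDegree_linear_pow_le (a e : ℝ) (i : ℕ) : ((C e - C a * X) ^ i).natDegree ≤ i :=
  natDegree_pow_le_of_le i (m := 1) (by compute_degree) |>.trans_eq (mul_one i)

theorem coeff_zero_linear_pow (a e : ℝ) (i : ℕ) : ((C e - C a * X) ^ i).coeff 0 = e ^ i := by
  simp [coeff_zero_eq_eval_zero]

theorem coeff_one_linear_pow (he : e ≠ 0) (i : ℕ) :
    ((C e - C a * X) ^ i).coeff 1 = jetRatio a e i * e ^ i := by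
  induction i with
  | zero => simp [jetRatio, coeff_one]
  | succ i ih =>
    rw [pow_succ, mul_coeff_one, ih, coeff_zero_linear_pow, coeff_sub, coeff_sub, coeff_C_zero,
      coeff_C_of_ne_zero one_ne_zero, mul_coeff_zero, coeff_X_zero, coeff_C_mul, coeff_X_one,
      jetRatio, jetRatio]
    push_cast
    field_simp
    ring

theorem linear_pow_mem_jetSpace (he : e ≠ 0) (hmq : m ≤ q) :
    (C e - C a * X) ^ m ∈ jetSpace (jetRatio a e m) q :=
  mem_jetSpace.2 ⟨(natDegree_linear_pow_le a e m).trans hmq, by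
    rw [coeff_one_linear_pow he, coeff_zero_linear_pow]⟩

theorem coeff_basisPoly_self (j : ℕ) : (basisPoly a e k j).coeff j = e ^ (k - j / 2) := by
  rw [basisPoly, coeff_mul_X_pow', if_pos le_rfl, Nat.sub_self, coeff_zero_linear_pow]

theorem basisPoly_mem_coeffIcc {j : ℕ} (hj : j ≤ q) (hq : 2 * k ≤ q) :
    basisPoly a e k j ∈ coeffIcc j q := by
  intro i hi
  rcases lt_or_ge i j with hij | hij
  · rw [basisPoly, coeff_mul_X_pow', if_neg hij.not_ge]
  · refine coeff_eq_zero_of_natDegree_lt ((natDegree_mul_le).trans_lt ?_)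
    have := natDegree_linear_pow_le a e (k - j / 2)
    have : ¬ i ≤ q := fun hiq => hi ⟨hij, hiq⟩
    rw [natDegree_X_pow]
    lia

theorem basisPoly_injective (he : e ≠ 0) : Function.Injective (basisPoly a e k) := by
  intro i j hij
  by_contra! hne
  wlog hlt : i < j generalizing i j
  · exact this hij.symm hne.symm (hne.lt_or_gt.resolve_left hlt)
  have h := coeff_basisPoly_self (a := a) (e := e) (k := k) i
  rw [hij, basisPoly, coeff_mul_X_pow', if_neg hlt.not_ge] at h
  exact pow_ne_zero _ he h.symm

theorem span_basisPoly_Icc (he : e ≠ 0) (hq : 2 * k ≤ q) :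
    Submodule.span ℝ (basisPoly a e k '' Set.Icc p q) = coeffIcc p q :=
  span_image_eq_coeffIcc (fun _ hj => basisPoly_mem_coeffIcc hj.2 hq)
    fun j _ => by rw [coeff_basisPoly_self]; exact pow_ne_zero _ he

theorem span_basisPoly_insert (he : e ≠ 0) (hq : 2 * k ≤ q) :
    Submodule.span ℝ (basisPoly a e k '' insert 0 (Set.Icc 2 q)) =
      jetSpace (jetRatio a e k) q := by
  have hmem : basisPoly a e k 0 ∈ jetSpace (jetRatio a e k) q := by
    simpa [basisPoly] using linear_pow_mem_jetSpace (a := a) he (by lia : k ≤ q)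
  rw [Set.image_insert_eq, Submodule.span_insert, span_basisPoly_Icc he hq,
    jetSpace_eq_span_singleton_sup hmem]
  rw [coeff_basisPoly_self]
  exact pow_ne_zero _ he

/-- The sequence `x^k, x^k y, x^(k-1), x^(k-1) y, …, x, x y, 1, y, …, y^k` in `ℝ[C]`. -/
noncomputable def basisElem (a e : ℝ) (k j : ℕ) : CoordRing (curve6 a 0 e) :=
  ofPoly a e k (basisPoly a e k j)

theorem basisElem_injective (he : e ≠ 0) : Function.Injective (basisElem a e k) :=
  (ofPoly_injective he k).comp (basisPoly_injective he)

theorem span_basisElem (S : Set ℕ) :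
    Submodule.span ℝ (basisElem a e k '' S) =
      (Submodule.span ℝ (basisPoly a e k '' S)).map (ofPoly a e k) := by
  rw [Submodule.map_span, ← Set.image_comp]
  rfl

theorem x_pow_mul_y_pow_eq_basisElem (he : e ≠ 0) {i l : ℕ} (hi : i ≤ k) (hl : l ≤ 1 ∨ i = 0) :
    x ^ i * y ^ l = basisElem a e k (2 * (k - i) + l) := by
  rw [x_pow_mul_y_pow he hi, basisElem, basisPoly]
  congr 3
  lia

theorem x_pow_eq_basisElem (he : e ≠ 0) {i : ℕ} (hi : i ≤ k) :
    x ^ i = basisElem a e k (2 * (k - i)) := by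
  simpa using x_pow_mul_y_pow_eq_basisElem (a := a) he hi (l := 0) (by simp)

theorem x_pow_mul_y_eq_basisElem (he : e ≠ 0) {i : ℕ} (hi : i ≤ k) :
    x ^ i * y = basisElem a e k (2 * (k - i) + 1) := by
  simpa using x_pow_mul_y_pow_eq_basisElem (a := a) he hi (l := 1) (by simp)

theorem y_pow_eq_basisElem (he : e ≠ 0) (j : ℕ) : y ^ j = basisElem a e k (2 * k + j) := by
  simpa using x_pow_mul_y_pow_eq_basisElem (a := a) he (Nat.zero_le k) (l := j) (by simp)

theorem basisB_eq (he : e ≠ 0) (hk : 1 ≤ k) :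
    basisB a 0 e k = basisElem a e k '' insert 0 (Set.Icc 2 (3 * k)) := by
  ext g
  constructor
  · rintro (rfl | ⟨i, hi, hik, rfl | rfl⟩ | ⟨j, hj, rfl⟩)
    · rw [x_pow_eq_basisElem he le_rfl]
      exact Set.mem_image_of_mem _ (by simp)
    · rw [x_pow_eq_basisElem he hik.le]
      exact Set.mem_image_of_mem _ (Or.inr ⟨by lia, by lia⟩)
    · rw [x_pow_mul_y_eq_basisElem he hik.le]
      exact Set.mem_image_of_mem _ (Or.inr ⟨by lia, by lia⟩)
    · rw [y_pow_eq_basisElem (k := k) he]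
      exact Set.mem_image_of_mem _ (Or.inr ⟨by lia, by lia⟩)
  · rintro ⟨j, rfl | ⟨hj2, hj⟩, rfl⟩
    · exact Or.inl (by rw [x_pow_eq_basisElem he le_rfl, Nat.sub_self])
    rcases le_or_gt (2 * k) j with hkj | hkj
    · exact Or.inr (Or.inr ⟨j - 2 * k, by lia, by
        rw [y_pow_eq_basisElem (k := k) he, Nat.add_sub_cancel' hkj]⟩)
    · refine Or.inr (Or.inl ⟨k - j / 2, by lia, by lia, ?_⟩)
      rw [x_pow_mul_y_eq_basisElem he (k.sub_le _), x_pow_eq_basisElem he (k.sub_le _)]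
      rcases j.even_or_odd' with ⟨i, rfl | rfl⟩
      · exact Or.inl (congrArg _ (by lia))
      · exact Or.inr (congrArg _ (by lia))

theorem basisElem_image_sdiff_singleton (he : e ≠ 0) (S : Set ℕ) (j : ℕ) :
    basisElem a e k '' S \ {basisElem a e k j} = basisElem a e k '' (S \ {j}) := by
  rw [Set.image_sdiff (basisElem_injective he), Set.image_singleton]

theorem basisB_sdiff_x_pow (he : e ≠ 0) (hk : 1 ≤ k) :
    basisB a 0 e k \ {x ^ k} = basisElem a e k '' Set.Icc 2 (3 * k) := by
  rw [basisB_eq he hk, x_pow_eq_basisElem he le_rfl, Nat.sub_self,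
    basisElem_image_sdiff_singleton he, Set.insert_sdiff_self_of_notMem (by simp)]

theorem basisBtilde_eq (he : e ≠ 0) (hk : 1 ≤ k) :
    basisBtilde a 0 e k = basisElem a e k '' Set.Icc 1 (3 * k) := by
  rw [basisBtilde, basisB_sdiff_x_pow he hk, x_pow_mul_y_eq_basisElem he le_rfl,
    ← Set.image_singleton, ← Set.image_union, Set.union_singleton, Nat.sub_self]
  exact congrArg _ (Set.insert_Icc_add_one_left_eq_Icc (by lia : 1 ≤ 3 * k))

theorem coordLE_le {S : Submodule ℝ (CoordRing (curve6 a 0 e))}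
    (h : ∀ i j, i + j ≤ m → x ^ i * y ^ j ∈ S) : CoordLE (curve6 a 0 e) m ≤ S := by
  rintro _ ⟨p, hp, rfl⟩
  rw [AlgHom.toLinearMap_apply, p.as_sum, map_sum]
  refine S.sum_mem fun s hs => ?_
  have h1 : s.degree ≤ m :=
    (MvPolynomial.le_totalDegree hs).trans ((MvPolynomial.mem_restrictTotalDegree _ _ _).1 hp)
  rw [MvPolynomial.monomial_eq, map_mul, ← MvPolynomial.algebraMap_eq, AlgHom.commutes,
    ← Algebra.smul_def, Finsupp.prod_fintype _ _ (by simp), Fin.prod_univ_two, map_mul, map_pow,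
    map_pow]
  refine S.smul_mem _ (h (s 0) (s 1) ?_)
  rwa [Finsupp.degree_eq_sum, Fin.sum_univ_two] at h1

theorem coordLE_le_map_jetSpace (he : e ≠ 0) (m : ℕ) :
    CoordLE (curve6 a 0 e) m ≤ (jetSpace (jetRatio a e m) (3 * m)).map (ofPoly a e m) := by
  refine coordLE_le fun i j hij => ⟨_, ?_, (x_pow_mul_y_pow he (by lia) j).symm⟩
  rcases eq_or_ne i m with rfl | him
  · obtain rfl : j = 0 := by lia
    simpa using linear_pow_mem_jetSpace (a := a) he (by lia : i ≤ 3 * i)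
  · refine coeffIcc_two_le_jetSpace fun l hl => ?_
    rw [coeff_mul_X_pow', ite_eq_right_iff]
    refine fun hle => coeff_eq_zero_of_natDegree_lt ((natDegree_linear_pow_le a e i).trans_lt ?_)
    have : ¬ l ≤ 3 * m := fun h => hl ⟨by lia, h⟩
    lia

theorem coordLE_eq (he : e ≠ 0) (hk : 1 ≤ k) :
    CoordLE (curve6 a 0 e) k = (jetSpace (jetRatio a e k) (3 * k)).map (ofPoly a e k) := by
  refine (coordLE_le_map_jetSpace he k).antisymm ?_
  rw [← span_basisPoly_insert he (by lia), ← span_basisElem, ← basisB_eq he hk]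
  exact Submodule.span_le.2 (basisB_subset a 0 e k)

theorem spaceU_eq (he : e ≠ 0) (hk : 1 ≤ k) :
    spaceU a 0 e k = (coeffIcc 2 (3 * k)).map (ofPoly a e k) := by
  rw [spaceU, basisB_sdiff_x_pow he hk, span_basisElem, span_basisPoly_Icc he (by lia)]

theorem spaceV_eq (he : e ≠ 0) (hk : 1 ≤ k) :
    spaceV a 0 e k = (coeffIcc 1 (3 * k)).map (ofPoly a e k) := by
  rw [spaceV, basisBtilde_eq he hk, span_basisElem, span_basisPoly_Icc he (by lia)]

theorem spaceW_eq (he : e ≠ 0) (hk : 1 ≤ k) :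
    spaceW a 0 e k = (jetSpace (jetRatio a e k) (3 * k - 1)).map (ofPoly a e k) := by
  have hset : insert 0 (Set.Icc 2 (3 * k)) \ {2 * k + k} = insert 0 (Set.Icc 2 (3 * k - 1)) := by
    ext j
    simp only [Set.mem_sdiff, Set.mem_insert_iff, Set.mem_Icc, Set.mem_singleton_iff]
    lia
  rw [spaceW, basisB_eq he hk, y_pow_eq_basisElem (k := k) he, basisElem_image_sdiff_singleton he,
    hset, span_basisElem, span_basisPoly_insert he (by lia)]

theorem spaceZ_eq (he : e ≠ 0) (hk : 1 ≤ k) :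
    spaceZ a 0 e k = (coeffIcc 1 (3 * k - 1)).map (ofPoly a e k) := by
  have hset : Set.Icc 1 (3 * k) \ {2 * k + k} = Set.Icc 1 (3 * k - 1) := by
    ext j
    simp only [Set.mem_sdiff, Set.mem_Icc, Set.mem_singleton_iff]
    lia
  rw [spaceZ, basisBtilde_eq he hk, y_pow_eq_basisElem (k := k) he,
    basisElem_image_sdiff_singleton he, hset, span_basisElem, span_basisPoly_Icc he (by lia)]

end Bases

section InducedForms

variable {K : Set (Fin 2 → ℝ)} {a d e : ℝ} {k m : ℕ}

theorem coordForm_eq_hankelForm {ℓ : CoordLE K (2 * k) →ₗ[ℝ] ℝ} {Λ : CoordRing K →ₗ[ℝ] ℝ}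
    (hΛ : Λ ∘ₗ (CoordLE K (2 * k)).subtype = ℓ) : coordForm ℓ = hankelForm Λ (CoordLE K k) :=
  LinearMap.ext₂ fun f g => (LinearMap.congr_fun hΛ ⟨f.1 * g.1, mul_mem_coordLE f.2 g.2⟩).symm

theorem curveLocalForm_eq_hankelForm (hk : 1 ≤ k)
    {ℓ : CoordLE (curve6 a d e) (2 * k) →ₗ[ℝ] ℝ} {Λ : CoordRing (curve6 a d e) →ₗ[ℝ] ℝ}
    (hΛ : Λ ∘ₗ (CoordLE (curve6 a d e) (2 * k)).subtype = ℓ) :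
    curveLocalForm a d e hk ℓ = hankelForm Λ (spaceV a d e k) :=
  LinearMap.ext₂ fun f g => by
    rw [hankelForm_apply, ← one_mul ((f : CoordRing (curve6 a d e)) * g)]
    exact (LinearMap.congr_fun hΛ
      ⟨1 * (f.1 * g.1), spaceV_mul_mem a d e hk f.1 f.2 g.1 g.2⟩).symm

theorem apply_toCoord_of_extends {L : PolyLE m →ₗ[ℝ] ℝ} {hL : Descends K L}
    {Λ : CoordRing K →ₗ[ℝ] ℝ}
    (hΛ : Λ ∘ₗ (CoordLE K m).subtype = inducedFunctional K L hL) (p : PolyLE m) :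
    Λ (toCoord K p) = L p := by
  rw [← inducedFunctional_apply K L hL p, ← hΛ]
  rfl

theorem exists_isotropic_of_not_isNonsingular {hk : 1 ≤ k} {L : PolyLE (2 * k) →ₗ[ℝ] ℝ}
    {hL : Descends (curve6 a d e) L} (hsing : ¬ IsNonsingular a d e hk L hL)
    {Λ : CoordRing (curve6 a d e) →ₗ[ℝ] ℝ}
    (hΛ : Λ ∘ₗ (CoordLE (curve6 a d e) (2 * k)).subtype =
      inducedFunctional (curve6 a d e) L hL) :
    ∃ f, (f ∈ CoordLE (curve6 a d e) k ∨ f ∈ spaceV a d e k) ∧ f ≠ 0 ∧ Λ (f * f) = 0 := by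
  rw [IsNonsingular, not_and_or] at hsing
  rcases hsing with hpoly | hlocal
  · have hle : idealLE (curve6 a d e) k ≤ formKer (polyForm L) := fun p hp =>
      LinearMap.mem_ker.2 (LinearMap.ext fun q => hL ⟨q.1 * p.1, mul_mem_polyLE q.2 p.2⟩
        (Ideal.mul_mem_left (MvPolynomial.vanishingIdeal ℝ (curve6 a d e)) q.1 hp))
    obtain ⟨p, hp, hpI⟩ := SetLike.exists_of_lt (hle.lt_of_ne' hpoly)
    refine ⟨toCoord _ p.1, .inl ⟨p.1, p.2, rfl⟩, fun h0 => hpI (toCoord_eq_zero_iff.1 h0), ?_⟩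
    rw [← map_mul, apply_toCoord_of_extends hΛ ⟨p.1 * p.1, mul_mem_polyLE p.2 p.2⟩]
    exact LinearMap.congr_fun (LinearMap.mem_ker.1 hp) p
  · obtain ⟨f, hf, hf0⟩ := Submodule.exists_mem_ne_zero_of_ne_bot hlocal
    rw [curveLocalForm_eq_hankelForm hk hΛ] at hf
    exact ⟨f, .inr f.2, by simpa using hf0, LinearMap.congr_fun (LinearMap.mem_ker.1 hf) f⟩

end InducedForms

section MomentFunctionals

open MeasureTheory

variable {K : Set (Fin 2 → ℝ)} {m : ℕ} {L : PolyLE m →ₗ[ℝ] ℝ}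

theorem isMomentFunctional_iff_exists_ae_mem :
    IsMomentFunctional K L ↔ ∃ μ : Measure (Fin 2 → ℝ), (∀ᵐ z ∂μ, z ∈ K) ∧
      ∀ p : PolyLE m, Integrable (fun z => MvPolynomial.eval z p.1) μ ∧
        L p = ∫ z, MvPolynomial.eval z p.1 ∂μ := by
  refine exists_congr fun μ => and_congr_right fun hμ => ?_
  simp only [IntegrableOn, Measure.restrict_eq_self_of_ae_mem hμ]

theorem isMomentFunctional_of_atomic {ι : Type*} {S : Finset ι} {w : ι → ℝ} {z : ι → Fin 2 → ℝ}
    (hz : ∀ i ∈ S, z i ∈ K) (hw : ∀ i ∈ S, 0 ≤ w i)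
    (hL : ∀ p : PolyLE m, L p = ∑ i ∈ S, w i * MvPolynomial.eval (z i) p.1) :
    IsMomentFunctional K L := by
  have hint (p : Poly) (i : ι) : Integrable (fun u => MvPolynomial.eval u p)
      (ENNReal.ofReal (w i) • Measure.dirac (z i)) :=
    (integrable_dirac (by simp)).smul_measure ENNReal.ofReal_ne_top
  refine isMomentFunctional_iff_exists_ae_mem.2
    ⟨∑ i ∈ S, ENNReal.ofReal (w i) • Measure.dirac (z i), ?_, fun p => ⟨?_, ?_⟩⟩
  · rw [ae_iff, Measure.coe_finsetSum, Finset.sum_apply]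
    refine Finset.sum_eq_zero fun i hi => ?_
    rw [Measure.smul_apply, Measure.dirac_apply, Set.indicator_of_notMem, smul_zero]
    exact fun h => h (hz i hi)
  · exact integrable_finsetSum_measure.2 fun i _ => hint p i
  · rw [integral_finsetSum_measure fun i _ => hint p i, hL]
    refine Finset.sum_congr rfl fun i hi => ?_
    rw [integral_smul_measure, integral_dirac, ENNReal.toReal_ofReal (hw i hi), smul_eq_mul]

variable {Λ : CoordRing K →ₗ[ℝ] ℝ} {f g : CoordRing K}

theorem IsMomentFunctional.apply_nonneg (hm : IsMomentFunctional K L)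
    (hΛ : ∀ p : PolyLE m, Λ (toCoord K p) = L p) (hf : f ∈ CoordLE K m)
    (hf0 : ∀ z (hz : z ∈ K), 0 ≤ evalAt z hz f) : 0 ≤ Λ f := by
  obtain ⟨μ, hμ, hLμ⟩ := isMomentFunctional_iff_exists_ae_mem.1 hm
  obtain ⟨p, hp, rfl⟩ := hf
  refine (integral_nonneg_of_ae (hμ.mono fun z hz => ?_)).trans_eq
    ((hΛ ⟨p, hp⟩).trans (hLμ ⟨p, hp⟩).2).symm
  exact hf0 z hz

theorem IsMomentFunctional.apply_eq_zero_of_dvd (hm : IsMomentFunctional K L)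
    (hΛ : ∀ p : PolyLE m, Λ (toCoord K p) = L p) (hf : f ∈ CoordLE K m)
    (hf0 : ∀ z (hz : z ∈ K), 0 ≤ evalAt z hz f) (hΛf : Λ f = 0) (hg : g ∈ CoordLE K m)
    (hfg : f ∣ g) : Λ g = 0 := by
  obtain ⟨μ, hμ, hLμ⟩ := isMomentFunctional_iff_exists_ae_mem.1 hm
  obtain ⟨p, hp, rfl⟩ := hf
  obtain ⟨q, hq, rfl⟩ := hg
  obtain ⟨h, hqh⟩ := hfg
  have hp0 : ∀ᵐ z ∂μ, MvPolynomial.eval z p = 0 :=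
    (integral_eq_zero_iff_of_nonneg_ae (hμ.mono fun z hz => hf0 z hz) (hLμ ⟨p, hp⟩).1).1
      ((hLμ ⟨p, hp⟩).2.symm.trans ((hΛ ⟨p, hp⟩).symm.trans hΛf))
  refine ((hΛ ⟨q, hq⟩).trans (hLμ ⟨q, hq⟩).2).trans (integral_eq_zero_of_ae ?_)
  filter_upwards [hμ, hp0] with z hz hpz
  have hqz := congrArg (evalAt z hz) hqh
  rw [map_mul] at hqz
  exact hqz.trans (mul_eq_zero_of_left hpz _)

end MomentFunctionals

section Curve

open Polynomial

variable {a e : ℝ} {k : ℕ} {Λ : CoordRing (curve6 a 0 e) →ₗ[ℝ] ℝ}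

theorem squarePositive_hankelForm_map_ofPoly_iff {S : Submodule ℝ ℝ[X]} :
    SquarePositive (hankelForm Λ (S.map (ofPoly a e k))) ↔
      ∀ F ∈ S, 0 ≤ Λ (ofPoly a e (2 * k) (F * F)) := by
  simp only [squarePositive_hankelForm_iff, ← ofPoly_mul_ofPoly]
  exact ⟨fun h F hF => h _ ⟨F, hF, rfl⟩, by rintro h _ ⟨F, hF, rfl⟩; exact h F hF⟩

theorem formRank_hankelForm_map_ofPoly_eq_iff (he : e ≠ 0) {S : Submodule ℝ ℝ[X]}
    [FiniteDimensional ℝ S] (hS : ∀ F ∈ S, 0 ≤ Λ (ofPoly a e (2 * k) (F * F))) {i : ℕ} {P : ℝ[X]}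
    (hP : P ∈ S) (hPi : P.coeff i ≠ 0) :
    formRank (hankelForm Λ (S.map (ofPoly a e k))) =
        formRank (restrictForm (hankelForm Λ (S.map (ofPoly a e k)))
          ((S ⊓ LinearMap.ker (lcoeff ℝ i)).map (ofPoly a e k))) ↔
      ∃ F ∈ S, F.coeff i ≠ 0 ∧ Λ (ofPoly a e (2 * k) (F * F)) = 0 := by
  simp only [← ofPoly_mul_ofPoly] at hS ⊢
  exact formRank_hankelForm_map_eq_iff (ofPoly_injective he k) hS hP hPi

theorem isFlatGapFunctional_comp_ofPoly_iff (he : e ≠ 0) (hk : 1 ≤ k) :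
    IsFlatGapFunctional (Λ ∘ₗ ofPoly a e (2 * k)) (jetRatio a e k) (3 * k) ↔
      SquarePositive (hankelForm Λ (CoordLE (curve6 a 0 e) k)) ∧
        SquarePositive (hankelForm Λ (spaceV a 0 e k)) ∧
        formRank (hankelForm Λ (CoordLE (curve6 a 0 e) k)) =
          formRank (restrictForm (hankelForm Λ (CoordLE (curve6 a 0 e) k)) (spaceU a 0 e k)) ∧
        (formRank (hankelForm Λ (CoordLE (curve6 a 0 e) k)) =
            formRank (restrictForm (hankelForm Λ (CoordLE (curve6 a 0 e) k))
              (spaceW a 0 e k)) ∨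
          formRank (hankelForm Λ (spaceV a 0 e k)) =
            formRank (restrictForm (hankelForm Λ (spaceV a 0 e k)) (spaceZ a 0 e k))) := by
  have h3k : 3 * k ≠ 0 := by lia
  have hlin : ((C e - C a * X) ^ k).coeff 0 ≠ 0 := by
    rw [coeff_zero_linear_pow]
    exact pow_ne_zero _ he
  have htop {p : ℕ} (hp : p ≤ 3 * k) : (X ^ (3 * k) : ℝ[X]) ∈ coeffIcc p (3 * k) :=
    X_pow_mem_coeffIcc hp le_rfl
  have htop0 : (X ^ (3 * k) : ℝ[X]).coeff (3 * k) ≠ 0 := by simp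
  rw [coordLE_eq he hk, spaceV_eq he hk, spaceU_eq he hk, spaceW_eq he hk, spaceZ_eq he hk,
    squarePositive_hankelForm_map_ofPoly_iff, squarePositive_hankelForm_map_ofPoly_iff,
    ← jetSpace_inf_ker_lcoeff_zero (c := jetRatio a e k), ← jetSpace_inf_ker_lcoeff h3k,
    ← coeffIcc_inf_ker_lcoeff h3k, isFlatGapFunctional_iff]
  refine and_congr_right fun hjet => and_congr_right fun htail => ?_
  rw [formRank_hankelForm_map_ofPoly_eq_iff he hjet (linear_pow_mem_jetSpace he (by lia)) hlin,
    formRank_hankelForm_map_ofPoly_eq_iff he hjet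
      (coeffIcc_two_le_jetSpace (htop (by lia))) htop0,
    formRank_hankelForm_map_ofPoly_eq_iff he htail (htop (by lia)) htop0]
  rfl

variable {L : PolyLE (2 * k) →ₗ[ℝ] ℝ}

theorem IsFlatGapFunctional.isMomentFunctional (he : e ≠ 0)
    (hΛ : ∀ p : PolyLE (2 * k), Λ (toCoord (curve6 a 0 e) p) = L p)
    (hM : IsFlatGapFunctional (Λ ∘ₗ ofPoly a e (2 * k)) (jetRatio a e k) (3 * k)) :
    IsMomentFunctional (curve6 a 0 e) L := by
  obtain ⟨S, w, hS, hrep⟩ := hM.exists_atomic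
  refine isMomentFunctional_of_atomic (S := S) (w := fun s => w s * s ^ (2 * (2 * k)))
    (z := curvePoint a e) (fun s hs => curvePoint_mem (hS s hs).1)
    (fun s hs => mul_nonneg (hS s hs).2.le (Even.pow_nonneg (even_two_mul _) s)) fun p => ?_
  obtain ⟨F, hF, hFp⟩ := coordLE_le_map_jetSpace he (2 * k) ⟨p.1, p.2, rfl⟩
  have hFp : ofPoly a e (2 * k) F = toCoord _ p.1 := hFp
  rw [jetRatio_two_mul, mul_left_comm 3 2 k] at hF
  rw [← hΛ, ← hFp]
  refine (hrep F hF).trans (Finset.sum_congr rfl fun s hs => ?_)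
  have hs0 : s ≠ 0 := (hS s hs).1
  rw [← evalAt_toCoord (curvePoint_mem hs0), ← hFp, evalAt_ofPoly hs0 he, mul_assoc,
    mul_inv_cancel_left₀ (pow_ne_zero _ hs0)]

theorem ofPoly_mul_self_mem_coordLE (he : e ≠ 0) (hk : 1 ≤ k) {F : ℝ[X]}
    (hF : F ∈ jetSpace (jetRatio a e k) (3 * k) ∨ F ∈ coeffIcc 1 (3 * k)) :
    ofPoly a e (2 * k) (F * F) ∈ CoordLE (curve6 a 0 e) (2 * k) := by
  rw [← ofPoly_mul_ofPoly]
  rcases hF with hF | hF <;> have hF := Submodule.mem_map_of_mem (f := ofPoly a e k) hF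
  · rw [← coordLE_eq he hk] at hF
    exact mul_mem_coordLE hF hF
  · rw [← spaceV_eq he hk] at hF
    simpa only [one_mul] using spaceV_mul_mem a 0 e hk _ hF _ hF

theorem exists_isotropic_polynomial (he : e ≠ 0) (hk : 1 ≤ k) {f : CoordRing (curve6 a 0 e)}
    (hf : f ∈ CoordLE (curve6 a 0 e) k ∨ f ∈ spaceV a 0 e k) (hf0 : f ≠ 0)
    (hff : Λ (f * f) = 0) :
    ∃ F, (F ∈ jetSpace (jetRatio a e k) (3 * k) ∨ F ∈ coeffIcc 1 (3 * k)) ∧ F ≠ 0 ∧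
      Λ (ofPoly a e (2 * k) (F * F)) = 0 := by
  rw [coordLE_eq he hk, spaceV_eq he hk] at hf
  obtain ⟨F, hF, rfl⟩ : ∃ F, (F ∈ jetSpace (jetRatio a e k) (3 * k) ∨
      F ∈ coeffIcc 1 (3 * k)) ∧ ofPoly a e k F = f := by
    rcases hf with ⟨F, hF, hFf⟩ | ⟨F, hF, hFf⟩
    exacts [⟨F, .inl hF, hFf⟩, ⟨F, .inr hF, hFf⟩]
  exact ⟨F, hF, by rintro rfl; exact hf0 (map_zero _), by rwa [← ofPoly_mul_ofPoly]⟩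

theorem IsMomentFunctional.isFlatGapFunctional (he : e ≠ 0) (hk : 1 ≤ k)
    (hm : IsMomentFunctional (curve6 a 0 e) L)
    (hΛ : ∀ p : PolyLE (2 * k), Λ (toCoord (curve6 a 0 e) p) = L p)
    (hsing : ∃ f, (f ∈ CoordLE (curve6 a 0 e) k ∨ f ∈ spaceV a 0 e k) ∧ f ≠ 0 ∧ Λ (f * f) = 0) :
    IsFlatGapFunctional (Λ ∘ₗ ofPoly a e (2 * k)) (jetRatio a e k) (3 * k) := by
  obtain ⟨f, hf, hf0, hff⟩ := hsing
  obtain ⟨F, hF, hF0, hFF⟩ := exists_isotropic_polynomial he hk hf hf0 hff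
  have hsq (G : ℝ[X]) (z) (hz : z ∈ curve6 a 0 e) :
      0 ≤ evalAt z hz (ofPoly a e (2 * k) (G * G)) := by
    rw [← ofPoly_mul_ofPoly, map_mul]
    exact mul_self_nonneg _
  have hnonneg {G : ℝ[X]}
      (hG : G ∈ jetSpace (jetRatio a e k) (3 * k) ∨ G ∈ coeffIcc 1 (3 * k)) :
      0 ≤ Λ (ofPoly a e (2 * k) (G * G)) :=
    hm.apply_nonneg hΛ (ofPoly_mul_self_mem_coordLE he hk hG) (hsq G)
  have hisotropic {G : ℝ[X]} {j : ℕ} (hFG : F ∣ X ^ j * G)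
      (hG : G ∈ jetSpace (jetRatio a e k) (3 * k) ∨ G ∈ coeffIcc 1 (3 * k)) :
      Λ (ofPoly a e (2 * k) (G * G)) = 0 := by
    refine hm.apply_eq_zero_of_dvd hΛ (ofPoly_mul_self_mem_coordLE he hk hF) (hsq F) hFF
      (ofPoly_mul_self_mem_coordLE he hk hG) (ofPoly_dvd_ofPoly (j := j + j) he ?_)
    rw [pow_add, mul_mul_mul_comm]
    exact mul_dvd_mul hFG hFG
  obtain ⟨P, hP, hP0, j, hFP⟩ := exists_mem_jetSpace_dvd_X_pow_mul hF hF0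
  obtain ⟨Q, hQ, hQn, hFQ⟩ := exists_coeff_top_ne_zero_dvd hF hF0
  exact ⟨fun G hG => hnonneg (.inl hG), fun G hG => hnonneg (.inr hG),
    ⟨P, hP, hP0, hisotropic hFP (.inl hP)⟩,
    ⟨Q, hQ, hQn, hisotropic (hFQ.mul_left (X ^ 0)) hQ⟩⟩

end Curve

end CubicTMP

theorem theorem4p5 (k : ℕ) (hk : 1 ≤ k) (a e : ℝ)
    (hirr : Irreducible (CubicTMP.P6 a 0 e))
    (L : CubicTMP.PolyLE (2 * k) →ₗ[ℝ] ℝ)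
    (hL : CubicTMP.Descends (CubicTMP.curve6 a 0 e) L)
    (hsing : ¬ CubicTMP.IsNonsingular a 0 e hk L hL) :
    CubicTMP.IsMomentFunctional (CubicTMP.curve6 a 0 e) L ↔
      CubicTMP.SquarePositive
          (CubicTMP.coordForm (CubicTMP.inducedFunctional (CubicTMP.curve6 a 0 e) L hL)) ∧
        CubicTMP.SquarePositive
          (CubicTMP.curveLocalForm a 0 e hk
            (CubicTMP.inducedFunctional (CubicTMP.curve6 a 0 e) L hL)) ∧
        CubicTMP.formRank
            (CubicTMP.coordForm (CubicTMP.inducedFunctional (CubicTMP.curve6 a 0 e) L hL)) =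
          CubicTMP.formRank
            (CubicTMP.restrictForm
              (CubicTMP.coordForm (CubicTMP.inducedFunctional (CubicTMP.curve6 a 0 e) L hL))
              (CubicTMP.spaceU a 0 e k)) ∧
        (CubicTMP.formRank
              (CubicTMP.coordForm (CubicTMP.inducedFunctional (CubicTMP.curve6 a 0 e) L hL)) =
            CubicTMP.formRank
              (CubicTMP.restrictForm
                (CubicTMP.coordForm (CubicTMP.inducedFunctional (CubicTMP.curve6 a 0 e) L hL))
                (CubicTMP.spaceW a 0 e k)) ∨
          CubicTMP.formRank
              (CubicTMP.curveLocalForm a 0 e hk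
                (CubicTMP.inducedFunctional (CubicTMP.curve6 a 0 e) L hL)) =
            CubicTMP.formRank
              (CubicTMP.restrictForm
                (CubicTMP.curveLocalForm a 0 e hk
                  (CubicTMP.inducedFunctional (CubicTMP.curve6 a 0 e) L hL))
                (CubicTMP.spaceZ a 0 e k))) := by
  have he := CubicTMP.ne_zero_of_irreducible hirr
  obtain ⟨Λ, hΛ⟩ := LinearMap.exists_extend (CubicTMP.inducedFunctional _ L hL)
  have hΛL := CubicTMP.apply_toCoord_of_extends hΛ
  rw [CubicTMP.coordForm_eq_hankelForm hΛ, CubicTMP.curveLocalForm_eq_hankelForm hk hΛ,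
    ← CubicTMP.isFlatGapFunctional_comp_ofPoly_iff he hk]
  have hisotropic := CubicTMP.exists_isotropic_of_not_isNonsingular hsing hΛ
  exact ⟨fun hm => hm.isFlatGapFunctional he hk hΛL hisotropic,
    fun hM => hM.isMomentFunctional he hΛL⟩
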